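/- **Theorem (Designs to PIR protocols).** Setting. There are $F\ge 1$ independent files $W_1,\dots,W_F$, each uniformly distributed on $\{0,1\}^L$, and $N$ servers; server $n$ stores, uncoded, a set $Z_n$ of bits of the files. The system is a $\mu$-$(F,N)$ system if every server stores exactly $\mu L$ bits of each file. To retrieve $W_\theta$, a user sends a random query $Q_n$ to each server $n$; the queries are generated independently of the files, and server $n$ returns a bit string $A_n$ that is a deterministic function of $Q_n$ and $Z_n$ and whose length is determined by $Q_n$. The protocol is *correct* if $H(W_\theta\mid A_1,\dots,A_N,Q_1,\dots,Q_N)=0$ for every $\theta\in[F]$, and *private* if $I(\theta;Q_n,A_n,Z_n)=0$ for every server $n$ (for every distribution of the index $\theta$). Its *rate* is $L$ divided by the expected total number of downloaded bits, and the *capacity* of the $\mu$-$(F,N)$ system is the supremum of the rates of all correct and private protocols on $\mu$-$(F,N)$ systems (over all file sizes $L\ge 1$ and all uncoded placements). A $(v,k,b,r)$-tactical configuration consists of $v$ points and $b\geq 1$ nonempty blocks (repeated blocks allowed) with $k$ points in each block and each point in exactly $r$ blocks; its incidence matrix $M$ has $M_{jn}=1$ if point $j$ lies in block $n$, and $M_{jn}=0$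 otherwise. Storage. Let $L=v\,r^F$, divide each file $W_i$ into $v$ subfiles $W_{i1},\dots,W_{iv}$ of $r^F$ bits each, and let server $n\in[b]$ store the subfile $W_{ij}$ of every file $i$ exactly when $M_{jn}=1$. Retrieval. For each $j\in[v]$, with independent randomness for different $j$, run the Sun–Jafar protocol on the subfiles $W_{1j},\dots,W_{Fj}$ and the servers that hold them, as follows. Permute the bits of each subfile by an independent uniformly random private permutation; call the permuted bits symbols. For every nonempty $S\subseteq[F]$ each server is asked for $(r-1)^{|S|-1}$ sums of type $S$, each the sum of one symbol from every file in $S$. If $\theta\in S$, each such sum at server $n$ is a new symbol of file $\theta$, plus, when $S\ne\{\theta\}$, one of the sums of type $S\setminus\{\theta\}$ requested from a server $n'\neq n$, each of these being used exactly once at each server $n\ne n'$; if $\theta\notin S$, the sum consists of new symbols only. The query to server $n$ is the (unordered) set of all sums requested from it, over all $j$ with $M_{jn}=1$, and the answer is the list of the values of these sums. Claim. The storage is that of a $\mu$-$(F,b)$ system with $\mu=r/b=k/v$. For each $j\in[v]$, the servers $n$ that store the subfile $W_{ij}$ are, for every $i\in[F]$, those with $M_{jn}=1$; there are exactly $r$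 of them, and with respect to the subfiles $W_{1j},\dots,W_{Fj}$ they form a $1$-$(F,r)$ system. The protocol is correct and private, its rate is $$\Big(\sum_{f=0}^{F-1} r^{-f}\Big)^{-1},$$ and this equals the capacity of the $\mu$-$(F,b)$ system with $\mu=r/b$. -/

import Mathlib

noncomputable section

namespace PIR

open Finset

/-! # Shannon entropy of random variables on a finite probability space (in bits) -/

/-- `H(X)` for a random variable `X` on the finite probability space `(Ω, p)`. -/
def entropy {Ω α : Type*} [Fintype Ω] (p : PMF Ω) (X : Ω → α) : ℝ :=
  haveI := Classical.decEq α
  ∑ x ∈ univ.image X, Real.negMulLog ((p.map X) x).toReal / Real.log 2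

/-- `H(X | Y) = H(X, Y) - H(Y)`. -/
def condEntropy {Ω α β : Type*} [Fintype Ω] (p : PMF Ω) (X : Ω → α) (Y : Ω → β) : ℝ :=
  entropy p (fun ω => (X ω, Y ω)) - entropy p Y

/-- `I(X ; Y) = H(X) + H(Y) - H(X, Y)`. -/
def mutualInfo {Ω α β : Type*} [Fintype Ω] (p : PMF Ω) (X : Ω → α) (Y : Ω → β) : ℝ :=
  entropy p X + entropy p Y - entropy p (fun ω => (X ω, Y ω))

/-! # Uncoded storage systems and PIR protocols

Files are indexed by `Fin F`, servers by `ι`, and the bits of every file by `B`, so that the file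
size is `L = Fintype.card B`. -/

/-- The contents of all files. -/
abbrev Files (F : ℕ) (B : Type) : Type := Fin F → B → ZMod 2

/-- Every server `n`, storing the (uncoded) bits `store n`, holds exactly `μ L` bits of each file. -/
def IsMuSystem {F : ℕ} {ι B : Type} [Fintype B] [DecidableEq B]
    (μ : ℝ) (store : ι → Finset (Fin F × B)) : Prop :=
  ∀ n i, (#{x : B | (i, x) ∈ store n} : ℝ) = μ * Fintype.card B

/-- A PIR protocol for `F` files on the servers `ι` with uncoded storage: which bits each server
stores, the joint law of the queries for each desired file, and the answer (a bit string, whose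
length is determined by the query) as a deterministic function of the query and of the content
of the server. -/
structure Protocol (F : ℕ) (ι B : Type) where
  /-- the pairs (file, bit) that are stored on a server -/
  store : ι → Finset (Fin F × B)
  /-- the possible queries to a server -/
  Query : ι → Type
  fintypeQuery : ∀ n, Fintype (Query n)
  /-- the law of the tuple of queries when file `θ` is desired -/
  queryLaw : Fin F → PMF (∀ n, Query n)
  /-- the answer to a query, given the stored bits -/
  answer : ∀ n, Query n → (store n → ZMod 2) → List (ZMod 2)
  /-- the number of bits of the answer to a query -/
  answerLength : ∀ n, Query n → ℕ
  length_answer : ∀ n q z, (answer n q z).length = answerLength n q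

namespace Protocol

variable {F : ℕ} {ι B : Type} [Fintype ι] [DecidableEq ι] [Fintype B] [DecidableEq B]

instance (P : Protocol F ι B) (n : ι) : Fintype (P.Query n) := P.fintypeQuery n

/-- The content `Z_n` of server `n`. -/
def content (P : Protocol F ι B) (w : Files F B) (n : ι) : P.store n → ZMod 2 :=
  fun x => w x.1.1 x.1.2

/-- The answer `A_n` of server `n`. -/
def reply (P : Protocol F ι B) (q : ∀ n, P.Query n) (w : Files F B) (n : ι) : List (ZMod 2) :=
  P.answer n (q n) (P.content w n)

/-- The joint law of all queries and all files when file `θ` is desired: the files are independent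
and uniformly distributed, and the queries are independent of the files. -/
def sessionLaw (P : Protocol F ι B) (θ : Fin F) : PMF ((∀ n, P.Query n) × Files F B) :=
  (P.queryLaw θ).bind fun q => (PMF.uniformOfFintype (Files F B)).map fun w => (q, w)

/-- The joint law of the desired index, all queries and all files, for an index drawn
according to `prior`. -/
def jointLaw (P : Protocol F ι B) (prior : PMF (Fin F)) :
    PMF (Fin F × (∀ n, P.Query n) × Files F B) :=
  prior.bind fun θ => (P.sessionLaw θ).map fun ω => (θ, ω)

/-- Correctness: `H(W_θ | A_1, …, A_N, Q_1, …, Q_N) = 0` for every desired index `θ`. -/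
def IsCorrect (P : Protocol F ι B) : Prop :=
  ∀ θ : Fin F, condEntropy (P.sessionLaw θ)
    (fun ω => ω.2 θ) (fun ω => (P.reply ω.1 ω.2, ω.1)) = 0

/-- Privacy: `I(θ ; Q_n, A_n, Z_n) = 0` for every server `n`, however the index is distributed. -/
def IsPrivate (P : Protocol F ι B) : Prop :=
  ∀ (prior : PMF (Fin F)) (n : ι), mutualInfo (P.jointLaw prior)
    (fun ω => ω.1) (fun ω => (ω.2.1 n, P.reply ω.2.1 ω.2.2 n, P.content ω.2.2 n)) = 0

/-- The expected number of downloaded bits when file `θ` is desired. -/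
def download (P : Protocol F ι B) (θ : Fin F) : ℝ :=
  ∑ q : (∀ n, P.Query n), (P.queryLaw θ q).toReal * ∑ n, (P.answerLength n (q n) : ℝ)

/-- The rate (file size over number of downloaded bits) is `R`, whichever file is desired. -/
def HasRate (P : Protocol F ι B) (R : ℝ) : Prop :=
  ∀ θ : Fin F, (Fintype.card B : ℝ) / P.download θ = R

end Protocol

/-- The rates of the correct and private protocols on `μ`-`(F, N)` systems, over all positive
file sizes and all uncoded placements of the files. -/
def achievableRates (F N : ℕ) (μ : ℝ) : Set ℝ :=
  {R | ∃ (B : Type) (_ : Fintype B) (_ : DecidableEq B) (_ : Nonempty B)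
      (P : Protocol F (Fin N) B),
      IsMuSystem μ P.store ∧ P.IsCorrect ∧ P.IsPrivate ∧ P.HasRate R}

/-- `c` is the capacity of the `μ`-`(F, N)` system. -/
def IsCapacity (F N : ℕ) (μ c : ℝ) : Prop :=
  IsLUB (achievableRates F N μ) c

/-! # The Sun–Jafar protocol

There are `F` files with `r ^ F` bits each, stored completely on each of `r` servers. The query to
a server is a set of sums of bits: for every nonempty set `S` of files, the server is asked for
`(r - 1) ^ (#S - 1)` sums of *type* `S`, each with one symbol of every file in `S`.

For the desired file `θ`, and for a type `S` that contains `θ`, every sum at server `n` consists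
of a new symbol of file `θ` and of one whole sum of type `S \ {θ}` (the side information)
requested from a server `n' ≠ n`; each such sum is used once in this way at each server `n ≠ n'`.
A sum of a type that does not contain `θ` consists of new symbols only (message symmetry).

Hence the sums of type `S` are indexed by the lists `n :: n' :: ⋯` in `walks ι #S`, where `n` is the
server from which the sum is requested. A symbol is named after the sum where it is new. The
symbols of file `k` are its bits in a uniformly random order, which is private to the user. -/

section SunJafar

/-- The sequences of `s` servers without equal neighbours. -/
def walks (ι : Type) [Fintype ι] [DecidableEq ι] : ℕ → Finset (List ι)
  | 0 => {[]}
  | s + 1 => {p ∈ (univ : Finset ι) ×ˢ walks ι s | p.2.head? ≠ some p.1}.image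
      fun p => p.1 :: p.2

variable {F : ℕ} {ι B : Type} [Fintype ι] [DecidableEq ι] [Fintype B] [DecidableEq B]

/-- The indices of the requested sums: a type and a sequence of servers, the first of which is the
server from which the sum is requested. -/
def sums (F : ℕ) (ι : Type) [Fintype ι] [DecidableEq ι] :
    Finset (Σ _ : Finset (Fin F), List ι) :=
  ({S | S.Nonempty} : Finset (Finset (Fin F))).sigma fun S => walks ι #S

/-- The names of the symbols of file `k`: the sums whose type contains `k`. -/
def symbols (ι : Type) [Fintype ι] [DecidableEq ι] (k : Fin F) :
    Finset (Σ _ : Finset (Fin F), List ι) :=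
  ({S | k ∈ S} : Finset (Finset (Fin F))).sigma fun S => walks ι #S

/-- The name of the symbol of file `k` in the sum `x`, for the desired file `θ`: the symbol is new
unless the sum uses side information and `k` is not desired. -/
def symbolAt (θ : Fin F) (x : Σ _ : Finset (Fin F), List ι) (k : Fin F) :
    Σ _ : Finset (Fin F), List ι :=
  if θ ∈ x.1 ∧ k ≠ θ then ⟨x.1.erase θ, x.2.tail⟩ else x

theorem symbolAt_mem (θ : Fin F) {x : Σ _ : Finset (Fin F), List ι} (hx : x ∈ sums F ι)
    {k : Fin F} (hk : k ∈ x.1) : symbolAt θ x k ∈ symbols ι k := by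
  obtain ⟨S, l⟩ := x
  simp only [sums, symbols, symbolAt, mem_sigma, mem_filter, mem_univ, true_and] at hx hk ⊢
  split_ifs with h
  · refine ⟨by simp [h.2, hk], ?_⟩
    obtain ⟨s, hs⟩ := Nat.exists_eq_succ_of_ne_zero (card_ne_zero_of_mem h.1)
    rw [card_erase_of_mem h.1]
    have h2 := hx.2
    rw [hs] at h2 ⊢
    simp only [walks, mem_image, mem_filter, mem_product] at h2
    obtain ⟨p, hp, rfl⟩ := h2
    exact hp.1.2
  · exact ⟨hk, hx.2⟩

theorem card_walks (s : ℕ) :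
    #(walks ι (s + 1)) = Fintype.card ι * (Fintype.card ι - 1) ^ s := by
  have hinj : Function.Injective fun p : ι × List ι => p.1 :: p.2 := by
    rintro ⟨a, l⟩ ⟨b, m⟩ h
    simpa using h
  induction s with
  | zero =>
    rw [walks, card_image_of_injective _ hinj, filter_true_of_mem]
    · simp [walks]
    · simp [walks]
  | succ s ih =>
    rw [walks, card_image_of_injective _ hinj, card_filter, sum_product_right, pow_succ, ← mul_assoc,
      ← ih, ← smul_eq_mul, ← sum_const]
    refine sum_congr rfl fun l hl => ?_
    rw [walks, mem_image] at hl
    obtain ⟨p, -, rfl⟩ := hl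
    rw [← card_filter]
    simp only [List.head?_cons, ne_eq, Option.some.injEq]
    rw [filter_ne, card_erase_of_mem (mem_univ _), card_univ]

theorem card_symbols (k : Fin F) : #(symbols ι k) = Fintype.card ι ^ F := by
  rw [symbols, card_sigma]
  have h : ({S | k ∈ S} : Finset (Finset (Fin F)))
      = ((univ.erase k).powerset).image (insert k) := by
    ext S
    simp only [mem_filter, mem_univ, true_and, mem_image, mem_powerset]
    constructor
    · exact fun h => ⟨S.erase k, erase_subset_erase _ (subset_univ _), insert_erase h⟩
    · rintro ⟨T, -, rfl⟩
      exact mem_insert_self _ _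
  have hk : ∀ T ∈ (univ.erase k).powerset, k ∉ T := fun T hT hkT => by
    simpa using mem_powerset.1 hT hkT
  rw [h, sum_image fun S hS T hT hST => by
    rw [← erase_insert (hk S hS), ← erase_insert (hk T hT), hST]]
  have hF : #(univ.erase k : Finset (Fin F)) = F - 1 := by simp
  have h1 : ∀ T ∈ (univ.erase k).powerset, #(walks ι #(insert k T)) =
      Fintype.card ι * ((Fintype.card ι - 1) ^ #T * 1 ^ (#(univ.erase k : Finset (Fin F)) - #T)) :=
    fun T hT => by rw [card_insert_of_notMem (hk T hT), card_walks, one_pow, mul_one]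
  rw [sum_congr rfl h1, ← mul_sum, sum_pow_mul_eq_add_pow, hF]
  obtain ⟨f, rfl⟩ := Nat.exists_eq_succ_of_ne_zero (Nat.pos_iff_ne_zero.1 (Fin.pos k))
  rcases Nat.eq_zero_or_pos (Fintype.card ι) with h0 | h0
  · simp [h0]
  · rw [Nat.sub_add_cancel h0, Nat.succ_sub_one, pow_succ']

/-- A fixed numbering of the symbols of file `k` by the `r ^ F` bit positions. -/
def numbering (hB : Fintype.card B = Fintype.card ι ^ F) (k : Fin F) : symbols ι k ≃ B :=
  Fintype.equivOfCardEq (by rw [Fintype.card_coe, card_symbols, hB])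

/-- The bits whose sum is requested as the sum `x`, for the desired file `θ` and the
permutations `γ` of the bits of the files. -/
def sumBits (hB : Fintype.card B = Fintype.card ι ^ F) (θ : Fin F) (γ : Fin F → Equiv.Perm B)
    (x : sums F ι) : Finset (Fin F × B) :=
  x.1.1.attach.image fun k =>
    (k.1, γ k.1 (numbering hB k.1 ⟨symbolAt θ x.1 k.1, symbolAt_mem θ x.2 k.2⟩))

/-- The query of the Sun–Jafar protocol to server `n`: a set of requested sums of bits. -/
def sunJafarQuery (hB : Fintype.card B = Fintype.card ι ^ F) (θ : Fin F)
    (γ : Fin F → Equiv.Perm B) (n : ι) : Finset (Finset (Fin F × B)) :=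
  ({x : sums F ι | x.1.2.head? = some n} : Finset (sums F ι)).image (sumBits hB θ γ)

end SunJafar

/-! # Tactical configurations and the protocol built from them -/

/-- A `(v, k, b, r)`-configuration: `b` nonempty blocks (repetitions are allowed) on `v` points,
with `k` points in each block and each point in exactly `r` blocks. -/
structure TacticalConfiguration (v k b r : ℕ) where
  block : Fin b → Finset (Fin v)
  block_nonempty : ∀ n, (block n).Nonempty
  card_block : ∀ n, #(block n) = k
  card_blocks_of_point : ∀ j, #{n | j ∈ block n} = r

namespace TacticalConfiguration

variable {v k b r : ℕ} (C : TacticalConfiguration v k b r) (F : ℕ)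

/-- The incidence matrix. -/
def incidence : Matrix (Fin v) (Fin b) ℕ :=
  Matrix.of fun j n => if j ∈ C.block n then 1 else 0

/-- The servers that hold the `j`-th subfiles. -/
abbrev Holder (j : Fin v) : Type := {n : Fin b // C.incidence j n = 1}

theorem card_holder (j : Fin v) : Fintype.card (C.Holder j) = r := by
  rw [Fintype.card_subtype]
  refine Eq.trans ?_ (C.card_blocks_of_point j)
  congr 1
  ext n
  simp [incidence]

/-- The bit positions of a file: `v` subfiles with `r ^ F` bits each. -/
abbrev Bit (v r F : ℕ) : Type := Fin v × Fin (r ^ F)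

/-- The storage scheme: server `n` stores the `j`-th subfile of every file if the entry `(j, n)` of
the incidence matrix is `1`. -/
def store (n : Fin b) : Finset (Fin F × Bit v r F) :=
  {x | C.incidence x.2.1 n = 1}

/-- The part of the storage that belongs to the `j`-th subfiles. -/
def subfileStore (j : Fin v) (n : Fin b) : Finset (Fin F × Fin (r ^ F)) :=
  {x | (x.1, (j, x.2)) ∈ C.store F n}

theorem mem_store {j : Fin v} {n : Fin b} (h : C.incidence j n = 1) (i : Fin F)
    (p : Fin (r ^ F)) : (i, (j, p)) ∈ C.store F n := by
  simpa [store] using h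

theorem card_bits_subfile (j : Fin v) :
    Fintype.card (Fin (r ^ F)) = Fintype.card (C.Holder j) ^ F := by
  rw [C.card_holder, Fintype.card_fin]

/-- The user's query to server `n`: the union, over all `j` such that server `n` holds the `j`-th
subfiles, of the queries of the Sun–Jafar protocol for the `j`-th subfiles on their holders, with
the permutations `γ j`. -/
def query (θ : Fin F) (γ : Fin v → Fin F → Equiv.Perm (Fin (r ^ F))) (n : Fin b) :
    Finset (Finset (C.store F n)) :=
  univ.biUnion fun j : Fin v =>
    if h : C.incidence j n = 1 then
      (sunJafarQuery (C.card_bits_subfile F j) θ (γ j) (⟨n, h⟩ : C.Holder j)).image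
        fun s => s.image fun x => ⟨(x.1, (j, x.2)), C.mem_store F h x.1 x.2⟩
    else ∅

/-- The protocol: for the desired file `θ`, the user draws independent uniformly random permutations
`γ` and sends the queries `C.query F θ γ`; each server answers with the list of the requested sums
of stored bits. -/
def protocol : Protocol F (Fin b) (Bit v r F) where
  store := C.store F
  Query n := Finset (Finset (C.store F n))
  fintypeQuery _ := inferInstance
  queryLaw θ := (PMF.uniformOfFintype (Fin v → Fin F → Equiv.Perm (Fin (r ^ F)))).map
    fun γ n => C.query F θ γ n
  answer _ q z := q.toList.map fun s => ∑ x ∈ s, z x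
  answerLength _ q := #q
  length_answer _ q z := by simp

end TacticalConfiguration

end PIR

end

/-! Achievability. All copies of the Sun–Jafar protocol run on disjoint bits. A symbol of the
desired file appears as a requested sum minus a side-information sum that is also requested, so it
can be decoded (`file_eq_of_sums_eq`). At a single server the sums involve pairwise distinct symbols
of each file (`symbolAt_injective`), so changing the desired file only relabels bits, and uniform
private permutations absorb the relabelling (`exists_perm_sunJafarQuery_eq`). There are `r * ∑ r ^
f` sums for each `j` (`card_sums`), which gives the rate.

Converse. For an arbitrary uncoded placement let `residual U k` be the entropy of the answers of the
servers in `U`, given the first `k` files and all bits stored outside `U`. If file `k` is desired,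
correctness turns its bits held only inside `U` into entropy (`residual_eq_of_correct`). For any
desired file, splitting off one server `u ∈ U` at a time and summing over `u` bounds `#U * residual
U k` below by single-server entropies plus the residuals of the sets `U.erase u` (`le_residual`). By
privacy the single-server entropies do not depend on the desired file, so they may be compared with
the case in which file `k` is desired. Induction on the number of unknown files and on `#U` shows
that a bit of file `i` with `h` holders costs at least `h ^ (-i)` downloaded bits
(`residualBound_le`, `desiredBound_le_download`). The number of holders averages `r` over the bits
of each file, so convexity gives at least `L * r ^ (-i)` for file `i` (`rate_le`), whatever the
placement. -/

noncomputable section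

namespace PIR

open Finset

/-! ### Entropy of weights on a finite set, and the Gibbs inequality. -/

section WeightedEntropy

variable {Ω α β γ : Type*} [Fintype Ω]

open Classical in
/-- The mass of the fiber of `X` through `ω`. -/
def fiberMass (p : Ω → ℝ) (X : Ω → α) (ω : Ω) : ℝ :=
  ∑ ω' with X ω' = X ω, p ω'

/-- The entropy, in nats, of `X` with respect to the weights `p`. -/
def natEntropy (p : Ω → ℝ) (X : Ω → α) : ℝ :=
  -∑ ω, p ω * Real.log (fiberMass p X ω)

theorem fiberMass_eq_sum_ite [DecidableEq α] (p : Ω → ℝ) (X : Ω → α) (ω : Ω) :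
    fiberMass p X ω = ∑ ω', if X ω' = X ω then p ω' else 0 := by
  rw [fiberMass, sum_filter]
  exact sum_congr rfl fun _ _ => by congr

theorem fiberMass_congr (p : Ω → ℝ) {X : Ω → α} {Y : Ω → β} {ω : Ω}
    (h : ∀ ω', X ω' = X ω ↔ Y ω' = Y ω) : fiberMass p X ω = fiberMass p Y ω := by
  classical
  unfold fiberMass
  congr 1
  ext ω'
  simp [h ω']

theorem natEntropy_congr (p : Ω → ℝ) {X : Ω → α} {Y : Ω → β}
    (h : ∀ ω ω', X ω' = X ω ↔ Y ω' = Y ω) : natEntropy p X = natEntropy p Y := by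
  unfold natEntropy
  simp_rw [fun ω => fiberMass_congr p (h ω)]

theorem fiberMass_eq_of_eq (p : Ω → ℝ) {X : Ω → α} {ω ω' : Ω} (h : X ω = X ω') :
    fiberMass p X ω = fiberMass p X ω' := by
  unfold fiberMass
  congr 1
  ext a
  simp [h]

theorem fiberMass_nonneg {p : Ω → ℝ} (hp : ∀ ω, 0 ≤ p ω) (X : Ω → α) (ω : Ω) :
    0 ≤ fiberMass p X ω := sum_nonneg fun ω' _ => hp ω'

theorem le_fiberMass {p : Ω → ℝ} (hp : ∀ ω, 0 ≤ p ω) (X : Ω → α) (ω : Ω) :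
    p ω ≤ fiberMass p X ω :=
  single_le_sum (f := p) (fun ω' _ => hp ω') (by simp)

theorem fiberMass_pos {p : Ω → ℝ} (hp : ∀ ω, 0 ≤ p ω) (X : Ω → α) {ω : Ω} (h : p ω ≠ 0) :
    0 < fiberMass p X ω :=
  (lt_of_le_of_ne (hp ω) h.symm).trans_le (le_fiberMass hp X ω)

theorem fiberMass_le_of_refines {p : Ω → ℝ} (hp : ∀ ω, 0 ≤ p ω) {X : Ω → α} {Y : Ω → β}
    (h : ∀ ω ω', X ω' = X ω → Y ω' = Y ω) (ω : Ω) : fiberMass p X ω ≤ fiberMass p Y ω := by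
  classical
  refine sum_le_sum_of_subset_of_nonneg (fun ω' => ?_) fun ω' _ _ => hp ω'
  simpa using h ω ω'

/-- Grouped by the values of `(f, g, h)`, the left side is the mass, on the support, of the law that
makes `f` and `g` conditionally independent given `h`; that law has the same total mass as `p`. -/
theorem sum_gibbs_le {p : Ω → ℝ} (hp : ∀ ω, 0 ≤ p ω) (f : Ω → α) (g : Ω → β) (h : Ω → γ) :
    ∑ ω, p ω * (fiberMass p (fun ω => (f ω, h ω)) ω * fiberMass p (fun ω => (g ω, h ω)) ω /
      (fiberMass p (fun ω => (f ω, g ω, h ω)) ω * fiberMass p h ω)) ≤ ∑ ω, p ω := by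
  classical
  set mm := fiberMass p (fun ω => (f ω, g ω, h ω)) with hmm
  set mh := fiberMass p h with hmh
  have h1 : ∀ ω, p ω * (fiberMass p (fun ω => (f ω, h ω)) ω *
      fiberMass p (fun ω => (g ω, h ω)) ω / (mm ω * mh ω)) =
      ∑ a, ∑ b, p a * p b * (if (f a = f ω ∧ h a = h ω) ∧ (g b = g ω ∧ h b = h ω) then
        p ω / (mm ω * mh ω) else 0) := by
    intro ω
    have : fiberMass p (fun ω => (f ω, h ω)) ω * fiberMass p (fun ω => (g ω, h ω)) ω =
        ∑ a, ∑ b, (if f a = f ω ∧ h a = h ω then p a else 0) *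
          (if g b = g ω ∧ h b = h ω then p b else 0) := by
      rw [← sum_mul_sum, fiberMass, fiberMass, sum_filter, sum_filter]
      simp only [Prod.mk.injEq]
    rw [this, mul_div_assoc', mul_div_right_comm, mul_sum]
    refine sum_congr rfl fun a _ => ?_
    rw [mul_sum]
    refine sum_congr rfl fun b _ => ?_
    by_cases ha : f a = f ω ∧ h a = h ω <;> by_cases hb : g b = g ω ∧ h b = h ω <;>
      simp [ha, hb]
    ring
  simp_rw [h1]
  rw [sum_comm]
  -- For fixed `a` and `b` the admissible `ω` form at most one fiber of `(f, g, h)`, whose mass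
  -- cancels `mm`. Only an inequality holds, as this fiber may be empty or null.
  have h2 : ∀ a b, ∑ ω, (if (f a = f ω ∧ h a = h ω) ∧ (g b = g ω ∧ h b = h ω) then
        p ω / (mm ω * mh ω) else 0) ≤ if h b = h a then (mh a)⁻¹ else 0 := by
    intro a b
    by_cases hex : ∃ ω, (f a = f ω ∧ h a = h ω) ∧ (g b = g ω ∧ h b = h ω)
    · obtain ⟨c, ⟨hc1, hc2⟩, hc3, hc4⟩ := hex
      rw [if_pos (hc4.trans hc2.symm)]
      have : ∀ ω, (if (f a = f ω ∧ h a = h ω) ∧ (g b = g ω ∧ h b = h ω) then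
          p ω / (mm ω * mh ω) else 0) =
          (if (f ω, g ω, h ω) = (f c, g c, h c) then p ω else 0) * (mm c * mh a)⁻¹ := by
        intro ω
        by_cases hω : (f ω, g ω, h ω) = (f c, g c, h c)
        · have e1 : mm ω = mm c := fiberMass_eq_of_eq p hω
          simp only [Prod.mk.injEq] at hω
          obtain ⟨ha, hb, hc⟩ := hω
          have e2 : mh ω = mh a := fiberMass_eq_of_eq p (hc.trans hc2.symm)
          simp [ha, hb, hc, hc1, hc2, hc3, hc4, e1, e2, div_eq_mul_inv]
        · rw [if_neg hω, if_neg, zero_mul]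
          rintro ⟨⟨h1, h2⟩, h3, h4⟩
          apply hω
          rw [← h1, ← h3, ← h2, hc1, hc3, hc2]
      simp_rw [this]
      rw [← sum_mul, ← sum_filter]
      have hc : ∑ ω with (f ω, g ω, h ω) = (f c, g c, h c), p ω = mm c := by
        rw [hmm, fiberMass]
        congr
      rw [hc]
      have h0 : 0 ≤ (mh a)⁻¹ := inv_nonneg.2 (fiberMass_nonneg hp _ _)
      rw [mul_inv, ← mul_assoc]
      exact mul_le_of_le_one_left h0 (mul_inv_le_one)
    · push Not at hex
      rw [sum_eq_zero]
      · split_ifs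
        · exact inv_nonneg.2 (fiberMass_nonneg hp _ _)
        · exact le_rfl
      · intro ω _
        rw [if_neg]
        rintro ⟨h1, h2⟩
        exact hex ω h1 h2.1 h2.2
  refine sum_le_sum fun a _ => ?_
  rw [sum_comm]
  calc _ ≤ ∑ b, p a * p b * (if h b = h a then (mh a)⁻¹ else 0) := by
        refine sum_le_sum fun b _ => ?_
        rw [← mul_sum]
        exact mul_le_mul_of_nonneg_left (h2 a b) (mul_nonneg (hp a) (hp b))
    _ = p a * (mh a * (mh a)⁻¹) := by
        rw [hmh, fiberMass, sum_filter, sum_mul, mul_sum]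
        refine sum_congr rfl fun b _ => ?_
        split_ifs <;> simp [mul_assoc]
    _ ≤ p a := mul_le_of_le_one_right (hp a) mul_inv_le_one

theorem gibbs_ratio_pos {p : Ω → ℝ} (hp : ∀ ω, 0 ≤ p ω) (f : Ω → α) (g : Ω → β) (h : Ω → γ)
    {ω : Ω} (hω : p ω ≠ 0) :
    0 < fiberMass p (fun ω => (f ω, h ω)) ω * fiberMass p (fun ω => (g ω, h ω)) ω /
      (fiberMass p (fun ω => (f ω, g ω, h ω)) ω * fiberMass p h ω) :=
  div_pos (mul_pos (fiberMass_pos hp _ hω) (fiberMass_pos hp _ hω))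
    (mul_pos (fiberMass_pos hp _ hω) (fiberMass_pos hp _ hω))

theorem natEntropy_deficit {p : Ω → ℝ} (hp : ∀ ω, 0 ≤ p ω) (f : Ω → α) (g : Ω → β) (h : Ω → γ) :
    natEntropy p (fun ω => (f ω, h ω)) + natEntropy p (fun ω => (g ω, h ω)) -
      natEntropy p (fun ω => (f ω, g ω, h ω)) - natEntropy p h =
    -∑ ω, p ω * Real.log (fiberMass p (fun ω => (f ω, h ω)) ω *
      fiberMass p (fun ω => (g ω, h ω)) ω /
      (fiberMass p (fun ω => (f ω, g ω, h ω)) ω * fiberMass p h ω)) := by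
  simp only [natEntropy, ← sum_neg_distrib, ← sum_add_distrib, ← sum_sub_distrib]
  refine sum_congr rfl fun ω _ => ?_
  by_cases hω : p ω = 0
  · simp [hω]
  have h1 := (fiberMass_pos hp (fun ω => (f ω, h ω)) hω).ne'
  have h2 := (fiberMass_pos hp (fun ω => (g ω, h ω)) hω).ne'
  have h3 := (fiberMass_pos hp (fun ω => (f ω, g ω, h ω)) hω).ne'
  have h4 := (fiberMass_pos hp h hω).ne'
  rw [Real.log_div (mul_ne_zero h1 h2) (mul_ne_zero h3 h4), Real.log_mul h1 h2,
    Real.log_mul h3 h4]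
  ring

/-- Entropy is submodular. -/
theorem natEntropy_submodular {p : Ω → ℝ} (hp : ∀ ω, 0 ≤ p ω) (f : Ω → α) (g : Ω → β)
    (h : Ω → γ) :
    natEntropy p (fun ω => (f ω, g ω, h ω)) + natEntropy p h ≤
      natEntropy p (fun ω => (f ω, h ω)) + natEntropy p (fun ω => (g ω, h ω)) := by
  have h1 := natEntropy_deficit hp f g h
  have h2 := sum_gibbs_le hp f g h
  have h3 : ∑ ω, p ω * Real.log (fiberMass p (fun ω => (f ω, h ω)) ω *
      fiberMass p (fun ω => (g ω, h ω)) ω /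
      (fiberMass p (fun ω => (f ω, g ω, h ω)) ω * fiberMass p h ω)) ≤
      ∑ ω, (p ω * (fiberMass p (fun ω => (f ω, h ω)) ω *
      fiberMass p (fun ω => (g ω, h ω)) ω /
      (fiberMass p (fun ω => (f ω, g ω, h ω)) ω * fiberMass p h ω)) - p ω) := by
    refine sum_le_sum fun ω _ => ?_
    by_cases hω : p ω = 0
    · simp [hω]
    have := mul_le_mul_of_nonneg_left
      (Real.log_le_sub_one_of_pos (gibbs_ratio_pos hp f g h hω)) (hp ω)
    rwa [mul_sub, mul_one] at this
  rw [sum_sub_distrib] at h3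
  linarith

/-- Equality case of submodularity: `log t ≤ t - 1` is strict unless `t = 1`, and a vanishing
deficit leaves no slack at any point of positive weight. -/
theorem gibbs_ratio_eq_one {p : Ω → ℝ} (hp : ∀ ω, 0 ≤ p ω) (f : Ω → α) (g : Ω → β) (h : Ω → γ)
    (heq : natEntropy p (fun ω => (f ω, h ω)) + natEntropy p (fun ω => (g ω, h ω)) -
      natEntropy p (fun ω => (f ω, g ω, h ω)) - natEntropy p h = 0) {ω : Ω} (hω : p ω ≠ 0) :
    fiberMass p (fun ω => (f ω, h ω)) ω * fiberMass p (fun ω => (g ω, h ω)) ω /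
      (fiberMass p (fun ω => (f ω, g ω, h ω)) ω * fiberMass p h ω) = 1 := by
  rw [natEntropy_deficit hp, neg_eq_zero] at heq
  have h2 := sum_gibbs_le hp f g h
  set t := fun ω => fiberMass p (fun ω => (f ω, h ω)) ω * fiberMass p (fun ω => (g ω, h ω)) ω /
      (fiberMass p (fun ω => (f ω, g ω, h ω)) ω * fiberMass p h ω) with ht
  change t ω = 1
  change ∑ ω, p ω * Real.log (t ω) = 0 at heq
  change ∑ ω, p ω * t ω ≤ _ at h2
  have hpos : ∀ ω, p ω ≠ 0 → 0 < t ω := fun ω hω => gibbs_ratio_pos hp f g h hω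
  have h0 : ∀ ω ∈ univ, 0 ≤ p ω * (t ω - 1 - Real.log (t ω)) := by
    intro ω _
    by_cases hω : p ω = 0
    · simp [hω]
    · exact mul_nonneg (hp ω) (by linarith [Real.log_le_sub_one_of_pos (hpos ω hω)])
  have hs : ∑ ω, p ω * (t ω - 1 - Real.log (t ω)) = 0 := by
    refine le_antisymm ?_ (sum_nonneg h0)
    simp only [mul_sub, sum_sub_distrib, mul_one]
    linarith
  have := (sum_eq_zero_iff_of_nonneg h0).1 hs ω (mem_univ _)
  rw [mul_eq_zero, or_iff_right hω] at this
  by_contra hne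
  have := Real.log_lt_sub_one_of_pos (hpos ω hω) hne
  linarith

end WeightedEntropy

/-! ### Entropy, conditional entropy and mutual information of a `PMF` through its weights. -/

section PMF

variable {Ω α β : Type*}

/-- The weights of a PMF as real numbers. -/
def weight (p : PMF Ω) (ω : Ω) : ℝ := (p ω).toReal

theorem weight_nonneg (p : PMF Ω) (ω : Ω) : 0 ≤ weight p ω := ENNReal.toReal_nonneg

theorem weight_ne_zero {p : PMF Ω} {ω : Ω} : weight p ω ≠ 0 ↔ p ω ≠ 0 := by
  simp [weight, ENNReal.toReal_eq_zero_iff, p.apply_ne_top]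

variable [Fintype Ω]

theorem sum_weight (p : PMF Ω) : ∑ ω, weight p ω = 1 := by
  have := p.tsum_coe
  rw [tsum_fintype] at this
  unfold weight
  rw [← ENNReal.toReal_sum fun ω _ => p.apply_ne_top ω, this, ENNReal.toReal_one]

open Classical in
theorem toReal_map_apply (p : PMF Ω) (X : Ω → α) (x : α) :
    (p.map X x).toReal = ∑ ω with X ω = x, weight p ω := by
  rw [PMF.map_apply, tsum_fintype, ENNReal.toReal_sum]
  · rw [sum_filter]
    refine sum_congr rfl fun ω _ => ?_
    by_cases h : X ω = x
    · simp [h, weight]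
    · simp [h, Ne.symm h]
  · intro ω _
    split_ifs
    · exact p.apply_ne_top ω
    · simp

theorem sum_weight_map [Fintype α] (p : PMF Ω) (X : Ω → α) (φ : α → ℝ) :
    ∑ x, weight (p.map X) x * φ x = ∑ ω, weight p ω * φ (X ω) := by
  classical
  rw [← sum_fiberwise_of_maps_to (s := univ) (t := univ) (g := X) (by simp)]
  refine sum_congr rfl fun x _ => ?_
  rw [weight, toReal_map_apply, sum_mul]
  refine sum_congr (by ext; simp) fun ω hω => ?_
  rw [(mem_filter.1 hω).2]

theorem entropy_eq (p : PMF Ω) (X : Ω → α) :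
    entropy p X = natEntropy (weight p) X / Real.log 2 := by
  classical
  rw [entropy, natEntropy, ← sum_div, ← sum_neg_distrib]
  congr 1
  rw [← sum_fiberwise_of_maps_to (s := univ) (t := univ.image X) (g := X) (by simp)]
  refine sum_congr (by ext; simp) fun x hx => ?_
  rw [toReal_map_apply, Real.negMulLog, neg_mul, sum_mul, ← sum_neg_distrib]
  refine sum_congr rfl fun ω hω => ?_
  have : X ω = x := (mem_filter.1 hω).2
  simp only [fiberMass, this]

/-- The conditional entropy averages the nonnegative logarithms of the ratio of the `Y`-fiber to the
`(X, Y)`-fiber. All vanish exactly when no `Y`-fiber has mass on two values of `X`. -/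
theorem condEntropy_eq_zero_iff (p : PMF Ω) (X : Ω → α) (Y : Ω → β) :
    condEntropy p X Y = 0 ↔
      ∀ ω ω', p ω ≠ 0 → p ω' ≠ 0 → Y ω = Y ω' → X ω = X ω' := by
  classical
  have hp := weight_nonneg p
  have hlog : Real.log 2 ≠ 0 := (Real.log_pos one_lt_two).ne'
  have hle : ∀ ω, fiberMass (weight p) (fun ω => (X ω, Y ω)) ω ≤ fiberMass (weight p) Y ω :=
    fun ω => fiberMass_le_of_refines hp (fun ω ω' h => (Prod.mk.inj h).2) ω
  have h1 : condEntropy p X Y = 0 ↔ ∑ ω, weight p ω * (Real.log (fiberMass (weight p) Y ω) -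
      Real.log (fiberMass (weight p) (fun ω => (X ω, Y ω)) ω)) = 0 := by
    rw [condEntropy, entropy_eq, entropy_eq, ← sub_div, div_eq_zero_iff, or_iff_left hlog,
      natEntropy, natEntropy]
    simp only [mul_sub, sum_sub_distrib]
    rw [neg_sub_neg]
  rw [h1, sum_eq_zero_iff_of_nonneg]
  · have h2 : ∀ ω, (weight p ω * (Real.log (fiberMass (weight p) Y ω) -
        Real.log (fiberMass (weight p) (fun ω => (X ω, Y ω)) ω)) = 0) ↔ (p ω ≠ 0 →
        ∀ ω', p ω' ≠ 0 → Y ω = Y ω' → X ω = X ω') := by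
      intro ω
      by_cases hω : p ω = 0
      · simp [hω, weight]
      have hω' := weight_ne_zero.2 hω
      rw [mul_eq_zero, or_iff_right hω', sub_eq_zero]
      have e : Real.log (fiberMass (weight p) Y ω) =
          Real.log (fiberMass (weight p) (fun ω => (X ω, Y ω)) ω) ↔
          fiberMass (weight p) Y ω - fiberMass (weight p) (fun ω => (X ω, Y ω)) ω = 0 := by
        rw [sub_eq_zero]
        exact ⟨fun h => Real.log_injOn_pos (fiberMass_pos hp _ hω') (fiberMass_pos hp _ hω') h,
          fun h => by rw [h]⟩
      rw [e, fiberMass, fiberMass, sum_filter, sum_filter, ← sum_sub_distrib,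
        sum_eq_zero_iff_of_nonneg]
      · simp only [hω, mem_univ, forall_true_left, ne_eq, not_false_eq_true]
        refine forall_congr' fun ω' => ?_
        by_cases hy : Y ω' = Y ω
        · by_cases hx : X ω' = X ω
          · simp [hx, hy]
          · have := @weight_ne_zero _ p ω'
            have hx' : ¬ X ω = X ω' := fun h => hx h.symm
            simp only [hy, hx, hx', Prod.mk.injEq, false_and, if_true, if_false, sub_zero]
            simp only [imp_false]
            exact not_iff_not.1 (by simpa using this)
        · simp [hy, Ne.symm hy]
      · intro ω' _
        by_cases hy : Y ω' = Y ω <;> by_cases hx : X ω' = X ω <;> simp [hx, hy, hp]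
    simp only [mem_univ, forall_true_left, h2]
    exact ⟨fun h ω ω' h1 h2 h3 => h ω h1 ω' h2 h3, fun h ω h1 ω' h2 h3 => h ω ω' h1 h2 h3⟩
  · intro ω _
    by_cases hω : p ω = 0
    · simp [hω, weight]
    · exact mul_nonneg (hp ω) (sub_nonneg.2 (Real.log_le_log
        (fiberMass_pos hp _ (weight_ne_zero.2 hω)) (hle ω)))

theorem mutualInfo_eq_zero_iff (p : PMF Ω) (X : Ω → α) (Y : Ω → β) :
    mutualInfo p X Y = 0 ↔ ∀ ω, p ω ≠ 0 →
      fiberMass (weight p) (fun ω => (X ω, Y ω)) ω =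
        fiberMass (weight p) X ω * fiberMass (weight p) Y ω := by
  classical
  have hp := weight_nonneg p
  have hlog : Real.log 2 ≠ 0 := (Real.log_pos one_lt_two).ne'
  -- Mutual information is conditional mutual information given a constant, so the equality case of
  -- submodularity applies.
  let h : Ω → Unit := fun _ => ()
  have h1 : ∀ ω, fiberMass (weight p) h ω = 1 := fun ω => by
    simp [fiberMass, h, sum_weight]
  have h2 : natEntropy (weight p) h = 0 := by simp [natEntropy, h1]
  have eX : ∀ ω, fiberMass (weight p) (fun ω => (X ω, h ω)) ω = fiberMass (weight p) X ω :=
    fun ω => fiberMass_congr _ (by simp [h])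
  have eY : ∀ ω, fiberMass (weight p) (fun ω => (Y ω, h ω)) ω = fiberMass (weight p) Y ω :=
    fun ω => fiberMass_congr _ (by simp [h])
  have eXY : ∀ ω, fiberMass (weight p) (fun ω => (X ω, Y ω, h ω)) ω =
      fiberMass (weight p) (fun ω => (X ω, Y ω)) ω :=
    fun ω => fiberMass_congr _ (by simp [h])
  have key : mutualInfo p X Y = (natEntropy (weight p) (fun ω => (X ω, h ω)) +
      natEntropy (weight p) (fun ω => (Y ω, h ω)) -
      natEntropy (weight p) (fun ω => (X ω, Y ω, h ω)) - natEntropy (weight p) h) /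
      Real.log 2 := by
    rw [mutualInfo, entropy_eq, entropy_eq, entropy_eq, h2]
    simp only [natEntropy, eX, eY, eXY]
    ring
  rw [key, div_eq_zero_iff, or_iff_left hlog]
  constructor
  · intro h0 ω hω
    have := gibbs_ratio_eq_one hp X Y h h0 (weight_ne_zero.2 hω)
    rw [eX, eY, eXY, h1, mul_one, div_eq_one_iff_eq
      (fiberMass_pos hp _ (weight_ne_zero.2 hω)).ne'] at this
    exact this.symm
  · intro h0
    rw [natEntropy_deficit hp, neg_eq_zero]
    refine sum_eq_zero fun ω _ => ?_
    by_cases hω : p ω = 0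
    · simp [hω, weight]
    · rw [eX, eY, eXY, h1, mul_one, ← h0 ω hω,
        div_self (fiberMass_pos hp _ (weight_ne_zero.2 hω)).ne', Real.log_one, mul_zero]

end PMF

/-- A nonnegative function of `Y` has expectation at most `P(X = x) E[ψ]` on the event `X = x`,
if the joint law of `X` and `Y` is the product law on its support. -/
theorem sum_filter_le_of_fiberMass_mul {Ω α β : Type*} [Fintype Ω] [DecidableEq α] {p : Ω → ℝ}
    (hp : ∀ ω, 0 ≤ p ω) {X : Ω → α} {Y : Ω → β}
    (h : ∀ ω, p ω ≠ 0 → fiberMass p (fun ω => (X ω, Y ω)) ω = fiberMass p X ω * fiberMass p Y ω)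
    {ψ : Ω → ℝ} (hψ : ∀ ω, 0 ≤ ψ ω) (hY : ∀ ω ω', Y ω = Y ω' → ψ ω = ψ ω') (x : α) :
    ∑ ω with X ω = x, p ω * ψ ω ≤ (∑ ω with X ω = x, p ω) * ∑ ω, p ω * ψ ω := by
  classical
  rw [← sum_fiberwise_of_maps_to (s := {ω | X ω = x}) (t := univ.image Y) (g := Y) (by simp),
    ← sum_fiberwise_of_maps_to (s := univ) (t := univ.image Y) (g := Y) (by simp), mul_sum]
  refine sum_le_sum fun y _ => ?_
  have hmul : 0 ≤ (∑ ω with X ω = x, p ω) * ∑ ω with Y ω = y, p ω * ψ ω :=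
    mul_nonneg (sum_nonneg fun ω _ => hp ω) (sum_nonneg fun ω _ => mul_nonneg (hp ω) (hψ ω))
  by_cases h0 : ∃ ω, (X ω = x ∧ Y ω = y) ∧ p ω ≠ 0
  · obtain ⟨ω, ⟨rfl, rfl⟩, hω⟩ := h0
    have h1 : ∑ a ∈ {a ∈ {a | X a = X ω} | Y a = Y ω}, p a * ψ a =
        fiberMass p (fun ω => (X ω, Y ω)) ω * ψ ω := by
      rw [fiberMass_eq_sum_ite, ← sum_filter, sum_mul, filter_filter]
      refine sum_congr (by ext; simp) fun a ha => ?_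
      rw [hY a ω (Prod.mk.inj (mem_filter.1 ha).2).2]
    have h2 : ∑ a with Y a = Y ω, p a * ψ a = fiberMass p Y ω * ψ ω := by
      rw [fiberMass, sum_mul]
      refine sum_congr (by ext; simp) fun a ha => ?_
      rw [hY a ω (mem_filter.1 ha).2]
    have h3 : ∑ a with X a = X ω, p a = fiberMass p X ω := by
      rw [fiberMass]
      exact sum_congr (by ext; simp) fun a ha => rfl
    rw [h1, h2, h3, h ω hω, mul_assoc]
  -- Factorisation is known only on the support. Off it the left side is zero and the right side is
  -- merely nonnegative, hence the inequality and the sign condition on `ψ`.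
  · push Not at h0
    rw [sum_eq_zero]
    · exact hmul
    · intro ω hω
      rw [filter_filter, mem_filter] at hω
      rw [h0 ω hω.2, zero_mul]

/-! ### Correctness and privacy as conditions on the law of the queries. -/

namespace Protocol

set_option linter.unusedSectionVars false

variable {F : ℕ} {ι B : Type} [Fintype ι] [DecidableEq ι] [Fintype B] [DecidableEq B]

theorem sessionLaw_apply (P : Protocol F ι B) (θ : Fin F) (q : ∀ n, P.Query n)
    (w : Files F B) : P.sessionLaw θ (q, w) =
      P.queryLaw θ q * (Fintype.card (Files F B) : ENNReal)⁻¹ := by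
  classical
  have h : ∀ q' : ∀ n, P.Query n,
      ((PMF.uniformOfFintype (Files F B)).map fun w => (q', w)) (q, w) =
        if q' = q then (Fintype.card (Files F B) : ENNReal)⁻¹ else 0 := by
    intro q'
    rw [PMF.map_apply]
    by_cases hq : q' = q
    · subst hq
      rw [tsum_eq_single w]
      · simp [PMF.uniformOfFintype_apply]
      · intro w' hw'
        simp [hw'.symm]
    · rw [ENNReal.tsum_eq_zero.2]
      · simp [hq]
      · intro w'
        simp [Ne.symm hq]
  rw [sessionLaw, PMF.bind_apply, tsum_eq_single q]
  · rw [h, if_pos rfl]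
  · intro q' hq'
    rw [h, if_neg hq', mul_zero]

theorem jointLaw_apply (P : Protocol F ι B) (prior : PMF (Fin F)) (θ : Fin F)
    (ω : (∀ n, P.Query n) × Files F B) :
    P.jointLaw prior (θ, ω) = prior θ * P.sessionLaw θ ω := by
  classical
  rw [jointLaw, PMF.bind_apply, tsum_eq_single θ]
  · congr 1
    rw [PMF.map_apply, tsum_eq_single ω]
    · simp
    · intro ω' h
      simp [h.symm]
  · intro θ' hθ'
    rw [PMF.map_apply, ENNReal.tsum_eq_zero.2, mul_zero]
    intro ω'
    simp [Ne.symm hθ']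

/-- The files are uniform and independent of the queries, so every content is possible together with
every possible query tuple. -/
theorem isCorrect_iff (P : Protocol F ι B) : P.IsCorrect ↔
    ∀ θ q, P.queryLaw θ q ≠ 0 → ∀ w w', P.reply q w = P.reply q w' → w θ = w' θ := by
  have hne : ∀ θ q w, P.sessionLaw θ (q, w) ≠ 0 ↔ P.queryLaw θ q ≠ 0 := by
    intro θ q w
    rw [sessionLaw_apply, mul_ne_zero_iff, and_iff_left]
    exact ENNReal.inv_ne_zero.2 (ENNReal.natCast_ne_top _)
  simp only [IsCorrect, condEntropy_eq_zero_iff]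
  refine forall_congr' fun θ => ⟨fun h q hq w w' hw => ?_, fun h => ?_⟩
  · exact h (q, w) (q, w') ((hne _ _ _).2 hq) ((hne _ _ _).2 hq) (Prod.ext hw rfl)
  · rintro ⟨q, w⟩ ⟨q', w'⟩ hq - he
    simp only [Prod.mk.injEq] at he
    obtain ⟨he, rfl⟩ := he
    exact h q ((hne _ _ _).1 hq) w w' he

/-- The expectation of a function of the queries when file `θ` is desired. -/
def expect (P : Protocol F ι B) (θ : Fin F) (φ : (∀ n, P.Query n) → ℝ) : ℝ :=
  ∑ q, weight (P.queryLaw θ) q * φ q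

theorem weight_jointLaw (P : Protocol F ι B) (prior : PMF (Fin F)) (θ : Fin F)
    (q : ∀ n, P.Query n) (w : Files F B) : weight (P.jointLaw prior) (θ, q, w) =
      weight prior θ * (weight (P.queryLaw θ) q * (Fintype.card (Files F B) : ℝ)⁻¹) := by
  simp [weight, jointLaw_apply, sessionLaw_apply]

theorem sum_weight_jointLaw (P : Protocol F ι B) (prior : PMF (Fin F))
    (ψ : Fin F × (∀ n, P.Query n) × Files F B → ℝ) :
    ∑ ω, weight (P.jointLaw prior) ω * ψ ω = ∑ θ, weight prior θ * P.expect θ fun q =>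
      (Fintype.card (Files F B) : ℝ)⁻¹ * ∑ w, ψ (θ, q, w) := by
  simp only [Fintype.sum_prod_type, weight_jointLaw, expect, mul_sum]
  refine sum_congr rfl fun θ _ => sum_congr rfl fun q _ => sum_congr rfl fun w _ => ?_
  ring

theorem card_files_ne_zero : (Fintype.card (Files F B) : ℝ) ≠ 0 :=
  Nat.cast_ne_zero.2 Fintype.card_ne_zero

theorem expect_const (P : Protocol F ι B) (θ : Fin F) (c : ℝ) :
    (P.expect θ fun _ => c) = c := by
  rw [expect, ← sum_mul, sum_weight, one_mul]

/-- What server `n` sees is a function of its own query and of the files, and the files are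
independent of the index and the queries. Thus only the law of the single query matters. -/
theorem isPrivate_of_expect_eq {P : Protocol F ι B}
    (h : ∀ n (φ : P.Query n → ℝ) θ θ',
      (P.expect θ fun q => φ (q n)) = P.expect θ' fun q => φ (q n)) : P.IsPrivate := by
  classical
  intro prior n
  rw [mutualInfo_eq_zero_iff]
  rintro ⟨θ, q, w⟩ -
  set Y : Fin F × (∀ n, P.Query n) × Files F B →
    P.Query n × List (ZMod 2) × (P.store n → ZMod 2) :=
    fun ω => (ω.2.1 n, P.reply ω.2.1 ω.2.2 n, P.content ω.2.2 n) with hY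
  -- `φ a` is the probability, over the files, that server `n` has the observed view when its query
  -- is `a`.
  let φ : P.Query n → ℝ := fun a => (Fintype.card (Files F B) : ℝ)⁻¹ * ∑ w',
    if (a, P.answer n a (P.content w' n), P.content w' n) = Y (θ, q, w) then 1 else 0
  have e1 : fiberMass (weight (P.jointLaw prior)) (fun ω => ω.1) (θ, q, w) = weight prior θ := by
    rw [fiberMass_eq_sum_ite]
    have := P.sum_weight_jointLaw prior fun ω => if ω.1 = θ then 1 else 0
    simp only [mul_ite, mul_one, mul_zero] at this
    refine Eq.trans this ?_
    rw [sum_eq_single θ]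
    · simp [expect_const]
    · intro θ' _ hθ'
      simp [hθ', expect_const]
    · simp
  have e2 : fiberMass (weight (P.jointLaw prior)) Y (θ, q, w) =
      P.expect θ fun q => φ (q n) := by
    rw [fiberMass_eq_sum_ite]
    have := P.sum_weight_jointLaw prior fun ω => if Y ω = Y (θ, q, w) then 1 else 0
    simp only [mul_ite, mul_one, mul_zero] at this
    refine Eq.trans this ?_
    calc _ = ∑ θ', weight prior θ' * P.expect θ fun q => φ (q n) :=
          sum_congr rfl fun θ' _ => by rw [h n φ θ θ']; rfl
      _ = _ := by rw [← sum_mul, sum_weight, one_mul]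
  have e3 : fiberMass (weight (P.jointLaw prior)) (fun ω => (ω.1, Y ω)) (θ, q, w) =
      weight prior θ * P.expect θ fun q => φ (q n) := by
    rw [fiberMass_eq_sum_ite]
    have := P.sum_weight_jointLaw prior
      fun ω => if (ω.1, Y ω) = (θ, Y (θ, q, w)) then 1 else 0
    simp only [mul_ite, mul_one, mul_zero] at this
    refine Eq.trans this ?_
    rw [sum_eq_single θ]
    · simp only [Prod.mk.injEq, true_and]
      rfl
    · intro θ' _ hθ'
      simp [hθ', expect_const]
    · simp
  rw [e1, e2, e3]

/-- The uniform prior gives every index positive probability. Independence then bounds each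
expectation by the average over all indices, and numbers that do not exceed their average are all
equal. -/
theorem IsPrivate.expect_eq {P : Protocol F ι B} (h : P.IsPrivate) (n : ι) {φ : P.Query n → ℝ}
    (hφ : ∀ a, 0 ≤ φ a) (θ θ' : Fin F) :
    (P.expect θ fun q => φ (q n)) = P.expect θ' fun q => φ (q n) := by
  classical
  have : Nonempty (Fin F) := ⟨θ⟩
  have hF : (0 : ℝ) < F := Nat.cast_pos.2 (Fin.pos θ)
  set prior := PMF.uniformOfFintype (Fin F) with hprior
  have hw : ∀ θ, weight prior θ = (F : ℝ)⁻¹ := fun θ => by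
    simp [weight, hprior, PMF.uniformOfFintype_apply]
  have h1 := (mutualInfo_eq_zero_iff _ _ _).1 (h prior n)
  have e : ∀ θ, (P.expect θ fun q => φ (q n)) ≤
      ∑ θ', (F : ℝ)⁻¹ * P.expect θ' fun q => φ (q n) := by
    intro θ
    have h2 := sum_filter_le_of_fiberMass_mul (weight_nonneg (P.jointLaw prior))
      (X := fun ω => ω.1)
      (Y := fun ω => (ω.2.1 n, P.reply ω.2.1 ω.2.2 n, P.content ω.2.2 n))
      (fun ω hω => h1 ω (weight_ne_zero.1 hω))
      (ψ := fun ω => φ (ω.2.1 n)) (fun ω => hφ _)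
      (fun ω ω' hω => by rw [(Prod.mk.inj hω).1]) θ
    rw [sum_filter, sum_filter, sum_weight_jointLaw] at h2
    have h3 := P.sum_weight_jointLaw prior fun ω => if ω.1 = θ then φ (ω.2.1 n) else 0
    have h4 := P.sum_weight_jointLaw prior fun ω => if ω.1 = θ then 1 else 0
    simp only [mul_ite, mul_one, mul_zero] at h3 h4
    rw [h3, h4] at h2
    have s1 : ∀ x : ℝ, (Fintype.card (Files F B) : ℝ)⁻¹ * ∑ _w : Files F B, x = x := by
      intro x
      rw [sum_const, card_univ, nsmul_eq_mul, inv_mul_cancel_left₀ card_files_ne_zero]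
    simp only [s1, hw] at h2
    rw [sum_eq_single θ, sum_eq_single θ] at h2
    · simp only [if_true, expect_const, s1, mul_one] at h2
      exact le_of_mul_le_mul_left h2 (inv_pos.2 hF)
    · intro θ' _ hθ'
      simp [hθ', expect_const]
    · simp
    · intro θ' _ hθ'
      simp [hθ', expect_const]
    · simp
  have key : ∀ θ, (P.expect θ fun q => φ (q n)) =
      ∑ θ', (F : ℝ)⁻¹ * P.expect θ' fun q => φ (q n) := by
    set A := ∑ θ', (F : ℝ)⁻¹ * P.expect θ' fun q => φ (q n) with hA
    have hs : ∑ θ, (A - P.expect θ fun q => φ (q n)) = 0 := by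
      rw [sum_sub_distrib, sum_const, card_univ, Fintype.card_fin, nsmul_eq_mul, hA, ← mul_sum,
        mul_inv_cancel_left₀ hF.ne', sub_self]
    intro θ
    have := (sum_eq_zero_iff_of_nonneg fun θ _ => sub_nonneg.2 (e θ)).1 hs θ (mem_univ _)
    linarith
  rw [key θ, key θ']

end Protocol

/-! ### Chain rule, subadditivity and the cardinality bound for entropy. -/

section CondEntropy

variable {Ω α β γ δ : Type*} [Fintype Ω]

/-- The conditional entropy, in nats, of `f` given `g` with respect to the weights `p`. -/
def condNatEntropy (p : Ω → ℝ) (f : Ω → α) (g : Ω → β) : ℝ :=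
  natEntropy p (fun ω => (f ω, g ω)) - natEntropy p g

theorem natEntropy_le_of_refines {p : Ω → ℝ} (hp : ∀ ω, 0 ≤ p ω) {X : Ω → α} {Y : Ω → β}
    (h : ∀ ω ω', X ω' = X ω → Y ω' = Y ω) : natEntropy p Y ≤ natEntropy p X := by
  refine neg_le_neg (sum_le_sum fun ω _ => ?_)
  by_cases hω : p ω = 0
  · simp [hω]
  · exact mul_le_mul_of_nonneg_left (Real.log_le_log (fiberMass_pos hp _ hω)
      (fiberMass_le_of_refines hp h ω)) (hp ω)

theorem condNatEntropy_nonneg {p : Ω → ℝ} (hp : ∀ ω, 0 ≤ p ω) (f : Ω → α) (g : Ω → β) :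
    0 ≤ condNatEntropy p f g :=
  sub_nonneg.2 (natEntropy_le_of_refines hp fun _ _ h => (Prod.mk.inj h).2)

theorem condNatEntropy_congr (p : Ω → ℝ) {f : Ω → α} {f' : Ω → β} (g : Ω → γ)
    (h : ∀ ω ω', f ω' = f ω ↔ f' ω' = f' ω) :
    condNatEntropy p f g = condNatEntropy p f' g := by
  unfold condNatEntropy
  rw [natEntropy_congr p (X := fun ω => (f ω, g ω)) (Y := fun ω => (f' ω, g ω))]
  simp [h]

/-- Conditioning on more information reduces entropy. -/
theorem condNatEntropy_le_of_refines {p : Ω → ℝ} (hp : ∀ ω, 0 ≤ p ω) (f : Ω → α) {g : Ω → β}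
    {g' : Ω → γ} (h : ∀ ω ω', g' ω' = g' ω → g ω' = g ω) :
    condNatEntropy p f g' ≤ condNatEntropy p f g := by
  have h1 := natEntropy_submodular hp f g' g
  have h2 : natEntropy p (fun ω => (f ω, g' ω, g ω)) = natEntropy p (fun ω => (f ω, g' ω)) :=
    natEntropy_congr p fun ω ω' => by
      simp only [Prod.mk.injEq]
      exact ⟨fun h => ⟨h.1, h.2.1⟩, fun h' => ⟨h'.1, h'.2, h _ _ h'.2⟩⟩
  have h3 : natEntropy p (fun ω => (g' ω, g ω)) = natEntropy p g' :=
    natEntropy_congr p fun ω ω' => by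
      simp only [Prod.mk.injEq]
      exact ⟨fun h => h.1, fun h' => ⟨h', h _ _ h'⟩⟩
  unfold condNatEntropy
  linarith

theorem condNatEntropy_prod (p : Ω → ℝ) (f : Ω → α) (f' : Ω → β) (g : Ω → γ) :
    condNatEntropy p (fun ω => (f ω, f' ω)) g =
      condNatEntropy p f g + condNatEntropy p f' (fun ω => (f ω, g ω)) := by
  unfold condNatEntropy
  rw [natEntropy_congr p (X := fun ω => ((f ω, f' ω), g ω)) (Y := fun ω => (f' ω, f ω, g ω))]
  · ring
  · intro ω ω'
    simp only [Prod.mk.injEq]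
    tauto

theorem condNatEntropy_le_sum {ι : Type*} [DecidableEq ι] {p : Ω → ℝ} (hp : ∀ ω, 0 ≤ p ω)
    (X : ι → Ω → α) (g : Ω → β) (V : Finset ι) :
    condNatEntropy p (fun ω (n : V) => X n ω) g ≤ ∑ n ∈ V, condNatEntropy p (X n) g := by
  induction V using Finset.induction_on with
  | empty =>
    rw [sum_empty, condNatEntropy, natEntropy_congr p (Y := g), sub_self]
    intro ω ω'
    simp [funext_iff]
  | insert a V ha ih =>
    rw [sum_insert ha, condNatEntropy_congr p (f' := fun ω => (X a ω, fun n : V => X n ω)) g,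
      condNatEntropy_prod]
    · refine add_le_add le_rfl (le_trans (condNatEntropy_le_of_refines hp _ ?_) ih)
      exact fun ω ω' h => (Prod.mk.inj h).2
    · intro ω ω'
      simp [funext_iff]

theorem natEntropy_le_log_card [Fintype α] {p : Ω → ℝ} (hp : ∀ ω, 0 ≤ p ω)
    (hsum : ∑ ω, p ω = 1) (X : Ω → α) : natEntropy p X ≤ Real.log (Fintype.card α) := by
  classical
  have hne : Nonempty Ω := by
    by_contra h
    rw [not_nonempty_iff] at h
    simp at hsum
  have hα : Nonempty α := hne.map X
  have hK : (0 : ℝ) < Fintype.card α := Nat.cast_pos.2 Fintype.card_pos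
  have h1 : ∑ ω, p ω * (fiberMass p X ω)⁻¹ ≤ Fintype.card α := by
    rw [← sum_fiberwise_of_maps_to (s := univ) (t := univ) (g := X) (by simp)]
    calc _ ≤ ∑ _a : α, (1 : ℝ) := by
          refine sum_le_sum fun a _ => ?_
          by_cases h : ∃ ω, X ω = a
          · obtain ⟨ω, rfl⟩ := h
            have : ∑ i with X i = X ω, p i * (fiberMass p X i)⁻¹ =
                fiberMass p X ω * (fiberMass p X ω)⁻¹ := by
              rw [fiberMass_eq_sum_ite, ← sum_filter, sum_mul]
              refine sum_congr rfl fun i hi => ?_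
              rw [fiberMass_eq_of_eq p (mem_filter.1 hi).2, fiberMass_eq_sum_ite, ← sum_filter]
            rw [this]
            exact mul_inv_le_one
          · push Not at h
            rw [sum_eq_zero]
            · exact zero_le_one
            · exact fun ω hω => absurd (mem_filter.1 hω).2 (h ω)
      _ = Fintype.card α := by simp
  -- This is `log t ≤ t - 1` at `t = 1 / (fiber mass * card α)`, the comparison with the uniform law
  -- on `α`.
  have h2 : ∀ ω, p ω * (-Real.log (fiberMass p X ω) - Real.log (Fintype.card α)) ≤
      p ω * (fiberMass p X ω)⁻¹ * (Fintype.card α : ℝ)⁻¹ - p ω := by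
    intro ω
    by_cases hω : p ω = 0
    · simp [hω]
    have hm := fiberMass_pos hp X hω
    have := mul_le_mul_of_nonneg_left (Real.log_le_sub_one_of_pos
      (inv_pos.2 (mul_pos hm hK))) (hp ω)
    rw [Real.log_inv, Real.log_mul hm.ne' hK.ne', mul_inv] at this
    linarith
  have h3 := sum_le_sum fun ω (_ : ω ∈ univ) => h2 ω
  simp only [mul_sub, sum_sub_distrib, ← sum_mul, mul_neg, sum_neg_distrib, hsum] at h3
  have h4 := mul_le_mul_of_nonneg_right h1 (inv_nonneg.2 hK.le)
  rw [mul_inv_cancel₀ hK.ne'] at h4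
  unfold natEntropy
  linarith

theorem condNatEntropy_le_natEntropy {p : Ω → ℝ} (hp : ∀ ω, 0 ≤ p ω)
    (hsum : ∑ ω, p ω = 1) (f : Ω → α) (g : Ω → β) :
    condNatEntropy p f g ≤ natEntropy p f := by
  have h1 := condNatEntropy_le_of_refines hp f (g := fun _ => ()) (g' := g) (by simp)
  have h2 : condNatEntropy p f (fun _ => ()) = natEntropy p f := by
    have : ∀ ω, fiberMass p (fun _ => ()) ω = 1 := fun ω => by simp [fiberMass, hsum]
    rw [condNatEntropy, natEntropy_congr p (Y := f) (by simp)]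
    simp [natEntropy, this]
  rwa [h2] at h1

end CondEntropy

/-! ### Entropy of a set of bits of uniform files. -/

section UniformFiles

set_option linter.unusedSectionVars false

variable {F : ℕ} {B : Type} [Fintype B] [DecidableEq B]

/-- The uniform weights on the contents of the files. -/
def uniformWeight (F : ℕ) (B : Type) [Fintype B] [DecidableEq B] : Files F B → ℝ :=
  fun _ => (Fintype.card (Files F B) : ℝ)⁻¹

theorem uniformWeight_nonneg (w : Files F B) : 0 ≤ uniformWeight F B w :=
  inv_nonneg.2 (Nat.cast_nonneg _)

theorem sum_uniformWeight : ∑ w, uniformWeight F B w = 1 := by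
  simp only [uniformWeight]
  rw [sum_const, card_univ, nsmul_eq_mul, mul_inv_cancel₀]
  exact Nat.cast_ne_zero.2 Fintype.card_ne_zero

/-- The bits of the files at the positions in `D`. -/
def bitsAt (D : Finset (Fin F × B)) (w : Files F B) : D → ZMod 2 := fun x => w x.1.1 x.1.2

theorem bitsAt_eq_iff {D : Finset (Fin F × B)} {w w' : Files F B} :
    bitsAt D w = bitsAt D w' ↔ ∀ i β, (i, β) ∈ D → w i β = w' i β := by
  simp [bitsAt, funext_iff]

theorem fiberMass_bitsAt (D : Finset (Fin F × B)) (w : Files F B) :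
    fiberMass (uniformWeight F B) (bitsAt D) w = (2⁻¹ : ℝ) ^ #D := by
  have h1 : ({w' | bitsAt D w' = bitsAt D w} : Finset (Files F B)) =
      Fintype.piFinset fun i => Fintype.piFinset fun β =>
        if (i, β) ∈ D then {w i β} else univ := by
    ext w'
    simp only [mem_filter, mem_univ, true_and, bitsAt_eq_iff, Fintype.mem_piFinset]
    refine forall_congr' fun i => forall_congr' fun β => ?_
    by_cases h : (i, β) ∈ D <;> simp [h]
  have h2 : (#({w' | bitsAt D w' = bitsAt D w} : Finset (Files F B)) : ℝ) =
      ∏ x : Fin F × B, if x ∈ D then 1 else 2 := by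
    rw [h1, Fintype.card_piFinset, Fintype.prod_prod_type]
    push_cast
    refine prod_congr rfl fun i _ => ?_
    rw [Fintype.card_piFinset]
    push_cast
    refine prod_congr rfl fun β _ => ?_
    by_cases h : (i, β) ∈ D <;> simp [h, ZMod.card]
  have h3 : (Fintype.card (Files F B) : ℝ) = ∏ _x : Fin F × B, 2 := by
    simp [Files, ZMod.card, pow_mul, Fintype.card_prod, pow_right_comm]
  rw [fiberMass_eq_sum_ite, ← sum_filter]
  simp only [uniformWeight]
  rw [sum_const, nsmul_eq_mul, h2, h3, ← prod_inv_distrib, ← prod_mul_distrib,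
    ← prod_const, ← prod_filter_mul_prod_filter_not univ (· ∈ D)]
  rw [prod_congr rfl (g := fun _ => (2⁻¹ : ℝ)) (fun x hx => by simp [(mem_filter.1 hx).2]),
    prod_eq_one (s := {x | x ∉ D}) (fun x hx => by simp [(mem_filter.1 hx).2]), mul_one]
  congr 1
  simp

theorem natEntropy_bitsAt (D : Finset (Fin F × B)) :
    natEntropy (uniformWeight F B) (bitsAt D) = #D * Real.log 2 := by
  unfold natEntropy
  simp only [fiberMass_bitsAt, Real.log_pow, Real.log_inv]
  rw [← sum_mul, sum_uniformWeight]
  ring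

end UniformFiles

/-! ### The converse: a lower bound for the download. -/

namespace Protocol

set_option linter.unusedSectionVars false

variable {F : ℕ} {ι B : Type} [Fintype ι] [DecidableEq ι] [Fintype B] [DecidableEq B]

theorem expect_mono (P : Protocol F ι B) (θ : Fin F) {φ ψ : (∀ n, P.Query n) → ℝ}
    (h : ∀ q, P.queryLaw θ q ≠ 0 → φ q ≤ ψ q) : P.expect θ φ ≤ P.expect θ ψ := by
  refine sum_le_sum fun q _ => ?_
  by_cases hq : weight (P.queryLaw θ) q = 0
  · simp [hq]
  · exact mul_le_mul_of_nonneg_left (h q (weight_ne_zero.1 hq)) (weight_nonneg _ _)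

theorem expect_add (P : Protocol F ι B) (θ : Fin F) (φ ψ : (∀ n, P.Query n) → ℝ) :
    (P.expect θ fun q => φ q + ψ q) = P.expect θ φ + P.expect θ ψ := by
  simp only [expect, mul_add, sum_add_distrib]

theorem expect_sum (P : Protocol F ι B) (θ : Fin F) {κ : Type*} (s : Finset κ)
    (φ : κ → (∀ n, P.Query n) → ℝ) :
    (P.expect θ fun q => ∑ i ∈ s, φ i q) = ∑ i ∈ s, P.expect θ (φ i) := by
  simp only [expect, mul_sum]
  exact sum_comm

theorem expect_mul_right (P : Protocol F ι B) (θ : Fin F) (φ : (∀ n, P.Query n) → ℝ) (c : ℝ) :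
    (P.expect θ fun q => φ q * c) = P.expect θ φ * c := by
  simp only [expect, sum_mul, mul_assoc]

/-- The servers that store the bit at the position `x`. -/
def holders (P : Protocol F ι B) (x : Fin F × B) : Finset ι := {n | x ∈ P.store n}

/-- The positions of the bits that belong to the first `k` files or are stored outside `U`. -/
def known (P : Protocol F ι B) (U : Finset ι) (k : ℕ) : Finset (Fin F × B) :=
  {x | x.1.val < k ∨ ¬ P.holders x ⊆ U}

theorem mem_known {P : Protocol F ι B} {U : Finset ι} {k : ℕ} {x : Fin F × B} :
    x ∈ P.known U k ↔ x.1.val < k ∨ ∃ n ∉ U, x ∈ P.store n := by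
  simp only [known, holders, mem_filter, mem_univ, true_and, not_subset]
  simp only [and_comm]

/-- The entropy of the answers of the servers in `U` to the queries `q`, given the first `k` files
and the contents of the other servers. -/
def residual (P : Protocol F ι B) (U : Finset ι) (k : ℕ) (q : ∀ n, P.Query n) : ℝ :=
  condNatEntropy (uniformWeight F B) (fun w (n : U) => P.reply q w n) (bitsAt (P.known U k))

theorem reply_eq_of_content_eq (P : Protocol F ι B) (q : ∀ n, P.Query n) {w w' : Files F B}
    {n : ι} (h : ∀ x ∈ P.store n, w x.1 x.2 = w' x.1 x.2) : P.reply q w n = P.reply q w' n := by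
  unfold reply
  congr 1
  funext x
  exact h x.1 x.2

theorem reply_eq_of_known {P : Protocol F ι B} {U : Finset ι} {k : ℕ} (q : ∀ n, P.Query n)
    {w w' : Files F B} (h : bitsAt (P.known U k) w = bitsAt (P.known U k) w') {n : ι}
    (hn : n ∉ U) : P.reply q w n = P.reply q w' n :=
  P.reply_eq_of_content_eq q fun x hx =>
    bitsAt_eq_iff.1 h x.1 x.2 (mem_known.2 (Or.inr ⟨n, hn, hx⟩))

theorem residual_nonneg (P : Protocol F ι B) (U : Finset ι) (k : ℕ) (q : ∀ n, P.Query n) :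
    0 ≤ P.residual U k q := condNatEntropy_nonneg uniformWeight_nonneg _ _

theorem card_known_succ (P : Protocol F ι B) (U : Finset ι) (θ : Fin F) :
    #(P.known U (θ + 1)) = #(P.known U θ) + #{β | P.holders (θ, β) ⊆ U} := by
  have h : P.known U (θ + 1) = P.known U θ ∪
      ({β | P.holders (θ, β) ⊆ U} : Finset B).image fun β => (θ, β) := by
    ext ⟨i, β⟩
    simp only [known, mem_filter, mem_univ, true_and, mem_union, mem_image, Prod.mk.injEq,
      Nat.lt_succ_iff_lt_or_eq]
    by_cases hi : i = θ
    · subst hi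
      simp
      tauto
    · have h1 : ¬ i.val = θ.val := fun h => hi (Fin.ext h)
      have h2 : ¬ θ = i := fun h => hi h.symm
      simp [h1, h2]
  rw [h, card_union_of_disjoint, card_image_of_injective]
  · exact fun a b h => (Prod.mk.inj h).2
  · rw [disjoint_right]
    rintro x hx
    obtain ⟨β, hβ, rfl⟩ := mem_image.1 hx
    have := (mem_filter.1 hβ).2
    simp [known, this]

/-- The replies of `U` and the known bits determine all replies, hence file `θ`. So the joint
entropy is unchanged when file `θ` becomes known, while the conditioning gains exactly its bits held
only inside `U`. -/
theorem residual_eq_of_correct {P : Protocol F ι B} (hP : P.IsCorrect) (U : Finset ι) (θ : Fin F)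
    {q : ∀ n, P.Query n} (hq : P.queryLaw θ q ≠ 0) :
    P.residual U θ q =
      #{β | P.holders (θ, β) ⊆ U} * Real.log 2 + P.residual U (θ + 1) q := by
  unfold residual condNatEntropy
  rw [natEntropy_bitsAt, natEntropy_bitsAt, card_known_succ, natEntropy_congr (uniformWeight F B)
    (X := fun w => ((fun n : U => P.reply q w n), bitsAt (P.known U θ) w))
    (Y := fun w => ((fun n : U => P.reply q w n), bitsAt (P.known U (θ + 1)) w))]
  · push_cast
    ring
  · intro w w'
    simp only [Prod.mk.injEq]
    refine and_congr_right fun h => ⟨fun h' => ?_, fun h' => ?_⟩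
    · have hθ : w' θ = w θ := by
        refine (isCorrect_iff P).1 hP θ q hq w' w (funext fun n => ?_)
        by_cases hn : n ∈ U
        · exact congr_fun h ⟨n, hn⟩
        · exact reply_eq_of_known q h' hn
      rw [bitsAt_eq_iff] at h' ⊢
      intro i β hi
      by_cases hi' : i = θ
      · rw [hi', hθ]
      · refine h' i β ?_
        rw [mem_known] at hi ⊢
        refine hi.imp_left fun h => ?_
        have : i.val ≠ θ.val := fun h => hi' (Fin.ext h)
        simp only at h ⊢
        omega
    · rw [bitsAt_eq_iff] at h' ⊢
      intro i β hi
      refine h' i β ?_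
      rw [mem_known] at hi ⊢
      exact hi.imp_left fun h => Nat.lt_succ_of_lt h

/-- The chain rule splits off the reply of `u`; the other replies are then conditioned further, on
the whole content of `u`, which determines that reply. -/
theorem le_residual (P : Protocol F ι B) {U : Finset ι} {u : ι} (hu : u ∈ U) (k : ℕ)
    (q : ∀ n, P.Query n) :
    condNatEntropy (uniformWeight F B) (fun w => P.reply q w u) (bitsAt (P.known U k)) +
      P.residual (U.erase u) k q ≤ P.residual U k q := by
  have h : P.residual U k q = condNatEntropy (uniformWeight F B)
      (fun w => (P.reply q w u, fun n : (U.erase u : Finset ι) => P.reply q w n))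
      (bitsAt (P.known U k)) := by
    refine condNatEntropy_congr _ _ fun w w' => ?_
    simp only [funext_iff, Subtype.forall, Prod.mk.injEq, mem_erase]
    constructor
    · exact fun h => ⟨h u hu, fun a ha => h a ha.2⟩
    · intro h a ha
      by_cases hau : a = u
      · rw [hau, h.1]
      · exact h.2 a ⟨hau, ha⟩
  rw [h, condNatEntropy_prod]
  refine add_le_add le_rfl (condNatEntropy_le_of_refines uniformWeight_nonneg _ ?_)
  intro w w' hw
  simp only [Prod.mk.injEq]
  refine ⟨reply_eq_of_known q hw (notMem_erase u U), ?_⟩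
  rw [bitsAt_eq_iff] at hw ⊢
  intro i β hi
  refine hw i β ?_
  rw [mem_known] at hi ⊢
  refine hi.imp_right ?_
  rintro ⟨n, hn, h⟩
  exact ⟨n, fun h' => hn (mem_of_mem_erase h'), h⟩

theorem residual_le_sum (P : Protocol F ι B) (U : Finset ι) (k : ℕ) (q : ∀ n, P.Query n) :
    P.residual U k q ≤ ∑ u ∈ U, condNatEntropy (uniformWeight F B) (fun w => P.reply q w u)
      (bitsAt (P.known U k)) :=
  condNatEntropy_le_sum uniformWeight_nonneg (fun u w => P.reply q w u) _ U

/-- The lower bound for the residual entropy, in bits. -/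
def residualBound (P : Protocol F ι B) (U : Finset ι) (k : ℕ) : ℝ :=
  ∑ x : Fin F × B with k ≤ x.1.val ∧ P.holders x ⊆ U,
    ((#(P.holders x) : ℝ)⁻¹) ^ (x.1.val - k + 1)

/-- The lower bound, in bits, for the residual entropy when the first unknown file is desired. -/
def desiredBound (P : Protocol F ι B) (U : Finset ι) (k : ℕ) : ℝ :=
  ∑ x : Fin F × B with k ≤ x.1.val ∧ P.holders x ⊆ U,
    ((#(P.holders x) : ℝ)⁻¹) ^ (x.1.val - k)

/-- Bits of file `θ` have exponent `0` and count `1` each; for later files the exponents `i - θ` and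
`i - (θ + 1) + 1` agree. -/
theorem desiredBound_eq (P : Protocol F ι B) (U : Finset ι) (θ : Fin F) :
    P.desiredBound U θ = #{β | P.holders (θ, β) ⊆ U} + P.residualBound U (θ + 1) := by
  unfold desiredBound residualBound
  rw [card_eq_sum_ones, Nat.cast_sum, ← sum_filter_add_sum_filter_not _
    (fun x : Fin F × B => x.1 = θ)]
  congr 1
  · refine sum_nbij' (fun x => x.2) (fun β => (θ, β)) ?_ ?_ ?_ ?_ ?_
    · rintro ⟨i, β⟩ h
      simp only [mem_filter, mem_univ, true_and] at h ⊢
      obtain ⟨⟨-, h⟩, rfl⟩ := h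
      exact h
    · intro β h
      simpa using h
    · rintro ⟨i, β⟩ h
      simp only [mem_filter, mem_univ, true_and] at h
      rw [h.2]
    · intro β h
      rfl
    · rintro ⟨i, β⟩ h
      simp only [mem_filter, mem_univ, true_and] at h
      simp [h.2]
  · rw [filter_filter]
    refine sum_congr ?_ ?_
    · ext ⟨i, β⟩
      simp only [mem_filter, mem_univ, true_and]
      have : i = θ ↔ i.val = θ.val := Fin.ext_iff
      rw [this]
      constructor
      · rintro ⟨⟨h1, h2⟩, h3⟩
        exact ⟨by omega, h2⟩
      · rintro ⟨h1, h2⟩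
        exact ⟨⟨by omega, h2⟩, by omega⟩
    · rintro ⟨i, β⟩ h
      simp only [mem_filter, mem_univ, true_and] at h
      congr 1
      simp only
      omega

/-- It holds bit by bit. A bit with `h` holders in `U` survives in `U.erase u` for `#U - h` choices
of `u`, and `#U * h ^ (-(j + 1)) = h ^ (-j) + (#U - h) * h ^ (-(j + 1))` for `h > 0`. -/
theorem card_mul_residualBound_le (P : Protocol F ι B) (U : Finset ι) (k : ℕ) :
    #U * P.residualBound U k ≤ P.desiredBound U k + ∑ u ∈ U, P.residualBound (U.erase u) k := by
  have h1 : ∑ u ∈ U, P.residualBound (U.erase u) k =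
      ∑ x : Fin F × B with k ≤ x.1.val ∧ P.holders x ⊆ U,
        (#(U \ P.holders x) : ℝ) * ((#(P.holders x) : ℝ)⁻¹) ^ (x.1.val - k + 1) := by
    unfold residualBound
    have h : ∀ x : Fin F × B, (#(U \ P.holders x) : ℝ) *
        ((#(P.holders x) : ℝ)⁻¹) ^ (x.1.val - k + 1) = ∑ u ∈ U \ P.holders x,
        ((#(P.holders x) : ℝ)⁻¹) ^ (x.1.val - k + 1) := by
      intro x
      rw [sum_const, nsmul_eq_mul]
    simp only [h]
    refine sum_comm' fun u x => ?_
    simp only [mem_filter, mem_univ, true_and, mem_sdiff, subset_erase]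
    tauto
  rw [h1, residualBound, desiredBound, mul_sum, ← sum_add_distrib]
  refine sum_le_sum fun x hx => ?_
  have hU := (mem_filter.1 hx).2.2
  have hc := card_le_card hU
  rw [card_sdiff_of_subset hU, Nat.cast_sub hc]
  rcases Nat.eq_zero_or_pos #(P.holders x) with h0 | h0
  · simp [h0]
  · have h0' : (#(P.holders x) : ℝ) ≠ 0 := by positivity
    apply le_of_eq
    rw [pow_succ]
    field_simp
    ring

/-- Privacy and correctness bound the residual entropy from below. -/
theorem residualBound_le {P : Protocol F ι B} (hc : P.IsCorrect) (hp : P.IsPrivate) {k m : ℕ}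
    (hk : k + m = F) (θ : Fin F) (U : Finset ι) :
    P.residualBound U k * Real.log 2 ≤ P.expect θ (P.residual U k) := by
  have hlog : 0 < Real.log 2 := Real.log_pos one_lt_two
  induction m generalizing k θ U with
  | zero =>
    rw [residualBound, sum_eq_zero, zero_mul]
    · exact sum_nonneg fun q _ => mul_nonneg (weight_nonneg _ _) (P.residual_nonneg _ _ _)
    · intro x hx
      have := (mem_filter.1 hx).2.1
      have := x.1.2
      omega
  | succ m ih =>
    -- If file `k` itself is desired, correctness peels it off and the outer induction hypothesis
    -- covers the later files.
    have hdes : ∀ U, P.desiredBound U k * Real.log 2 ≤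
        P.expect ⟨k, by omega⟩ (P.residual U k) := by
      intro U
      set κ : Fin F := ⟨k, by omega⟩ with hκ
      have h1 := P.desiredBound_eq U κ
      have h2 := ih (k := k + 1) (by omega) κ U
      change P.desiredBound U k = _ + P.residualBound U (k + 1) at h1
      rw [h1, add_mul]
      calc _ ≤ #{β | P.holders (κ, β) ⊆ U} * Real.log 2 + P.expect κ (P.residual U (k + 1)) :=
            add_le_add le_rfl h2
        _ = P.expect κ fun q => #{β | P.holders (κ, β) ⊆ U} * Real.log 2 +
              P.residual U (k + 1) q := by rw [expect_add, expect_const]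
        _ ≤ _ := P.expect_mono κ fun q hq => (residual_eq_of_correct hc U κ hq).ge
    obtain ⟨s, hs⟩ : ∃ s, #U = s := ⟨_, rfl⟩
    induction s generalizing U with
    | zero =>
      rw [card_eq_zero] at hs
      subst hs
      rw [residualBound, sum_eq_zero, zero_mul]
      · exact sum_nonneg fun q _ => mul_nonneg (weight_nonneg _ _) (P.residual_nonneg _ _ _)
      · intro x hx
        -- A bit without holders contributes a power of `0⁻¹ = 0`, which vanishes because the
        -- exponent is positive.
        have := subset_empty.1 (mem_filter.1 hx).2.2
        simp [this]
    | succ s ihs =>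
      have hU : (0 : ℝ) < #U := by rw [hs]; positivity
      set κ : Fin F := ⟨k, by omega⟩ with hκ
      set single : ι → (∀ n, P.Query n) → ℝ := fun u q => condNatEntropy (uniformWeight F B)
        (fun w => P.reply q w u) (bitsAt (P.known U k)) with hsingle
      have h1 : (∑ u ∈ U, P.expect θ (single u)) + ∑ u ∈ U, P.expect θ (P.residual (U.erase u) k)
          ≤ #U * P.expect θ (P.residual U k) := by
        rw [← sum_add_distrib, ← nsmul_eq_mul, ← sum_const]
        refine sum_le_sum fun u hu => ?_
        rw [← expect_add]
        exact P.expect_mono θ fun q _ => P.le_residual hu k q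
      -- Privacy enters here: a term that involves one query only can be computed as if file `k`
      -- were desired.
      have h2 : ∀ u, P.expect θ (single u) = P.expect κ (single u) := fun u =>
        hp.expect_eq u (φ := fun a => condNatEntropy (uniformWeight F B)
          (fun w => P.answer u a (P.content w u)) (bitsAt (P.known U k)))
          (fun a => condNatEntropy_nonneg uniformWeight_nonneg _ _) θ κ
      have h3 : P.expect κ (P.residual U k) ≤ ∑ u ∈ U, P.expect θ (single u) := by
        simp only [h2]
        rw [← expect_sum]
        exact P.expect_mono κ fun q _ => P.residual_le_sum U k q
      have h4 : ∑ u ∈ U, P.residualBound (U.erase u) k * Real.log 2 ≤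
          ∑ u ∈ U, P.expect θ (P.residual (U.erase u) k) :=
        sum_le_sum fun u hu => ihs (U.erase u) (by rw [card_erase_of_mem hu, hs]; rfl)
      rw [← sum_mul] at h4
      have h5 := mul_le_mul_of_nonneg_right (P.card_mul_residualBound_le U k) hlog.le
      have h6 := hdes U
      refine le_of_mul_le_mul_left ?_ hU
      linarith

/-- For `U = univ` and no file known, the residual is at most the sum of the entropies of the
answers, hence at most the download in bits. -/
theorem desiredBound_le_download {P : Protocol F ι B} (hc : P.IsCorrect) (hp : P.IsPrivate)
    {θ : Fin F} (hθ : θ.val = 0) : P.desiredBound univ 0 ≤ P.download θ := by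
  have hlog : 0 < Real.log 2 := Real.log_pos one_lt_two
  have h1 := residualBound_le hc hp (k := θ + 1) (m := F - (θ + 1)) (by omega) θ univ
  have h2 := P.desiredBound_eq univ θ
  have h3 : P.desiredBound univ θ * Real.log 2 ≤ P.expect θ (P.residual univ θ) := by
    rw [h2, add_mul]
    refine (add_le_add le_rfl h1).trans ?_
    rw [← P.expect_const θ (_ * Real.log 2), ← expect_add]
    exact P.expect_mono θ fun q hq => (residual_eq_of_correct hc univ θ hq).ge
  have h4 : P.expect θ (P.residual univ θ) ≤ P.download θ * Real.log 2 := by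
    change _ ≤ (P.expect θ fun q => ∑ n, (P.answerLength n (q n) : ℝ)) * Real.log 2
    rw [← expect_mul_right]
    refine P.expect_mono θ fun q _ => (P.residual_le_sum _ _ _).trans ?_
    rw [sum_mul]
    refine sum_le_sum fun n _ => (condNatEntropy_le_natEntropy uniformWeight_nonneg
      sum_uniformWeight _ _).trans ?_
    -- The query fixes the length of the answer, so the reply takes at most `2 ^ length` values.
    let V : Files F B → List.Vector (ZMod 2) (P.answerLength n (q n)) :=
      fun w => ⟨P.reply q w n, P.length_answer n (q n) (P.content w n)⟩
    rw [natEntropy_congr (uniformWeight F B) (Y := V)]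
    · refine (natEntropy_le_log_card uniformWeight_nonneg sum_uniformWeight V).trans ?_
      rw [card_vector, ZMod.card, Nat.cast_pow, Real.log_pow]
      simp
    · exact fun w w' => ⟨fun h => Subtype.ext h, fun h => congrArg Subtype.val h⟩
  rw [hθ] at h3
  exact le_of_mul_le_mul_right (h3.trans (by rw [hθ] at h4; exact h4)) hlog

/-- A bit stored nowhere could be flipped without changing any answer. The converse needs this
because the convexity estimate takes inverses of the numbers of holders. -/
theorem holders_nonempty {P : Protocol F ι B} (hc : P.IsCorrect) (x : Fin F × B) :
    (P.holders x).Nonempty := by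
  by_contra h
  rw [not_nonempty_iff_eq_empty] at h
  obtain ⟨q, hq⟩ := (P.queryLaw x.1).support_nonempty
  let w : Files F B := fun i β => if (i, β) = x then 1 else 0
  have h1 : P.reply q w = P.reply q 0 := by
    refine funext fun n => P.reply_eq_of_content_eq q fun y hy => ?_
    have : y ≠ x := by
      rintro rfl
      have : n ∈ P.holders y := by simpa [holders] using hy
      simp [h] at this
    simp [w, this]
  have h2 := congr_fun ((isCorrect_iff P).1 hc x.1 q hq w 0 h1) x.2
  simp [w] at h2

end Protocol

/-! ### Averaging over the placement, and the upper bound for the rate. -/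

theorem card_mul_inv_pow_le_sum {β : Type*} {s : Finset β} {a : β → ℝ} (ha : ∀ x ∈ s, 0 < a x)
    {r : ℝ} (hr : 0 < r) (hsum : ∑ x ∈ s, a x = r * #s) (m : ℕ) :
    #s * (r⁻¹) ^ m ≤ ∑ x ∈ s, ((a x)⁻¹) ^ m := by
  -- Jensen's inequality for `a ↦ a ^ (-m)` by its tangent at the mean `r`. The linear term sums to
  -- zero.
  have h1 : ∀ x ∈ s, (1 + m * (1 - a x / r)) * (r⁻¹) ^ m ≤ ((a x)⁻¹) ^ m := by
    intro x hx
    have hx0 := ha x hx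
    have e1 : 1 - a x / r ≤ r / a x - 1 := by
      have : r / a x - 1 - (1 - a x / r) = (r - a x) ^ 2 / (a x * r) := by
        field_simp
      have h : 0 ≤ (r - a x) ^ 2 / (a x * r) := by positivity
      linarith
    have e2 : 1 + (m : ℝ) * (r / a x - 1) ≤ (1 + (r / a x - 1)) ^ m :=
      one_add_mul_le_pow (by have : 0 < r / a x := by positivity
                             linarith) m
    have e3 : ((a x)⁻¹) ^ m = (1 + (r / a x - 1)) ^ m * (r⁻¹) ^ m := by
      rw [← mul_pow]
      congr 1
      field_simp
      ring
    rw [e3]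
    refine mul_le_mul_of_nonneg_right (le_trans ?_ e2) (by positivity)
    have := mul_le_mul_of_nonneg_left e1 (Nat.cast_nonneg (α := ℝ) m)
    linarith
  refine le_trans (le_of_eq ?_) (sum_le_sum h1)
  rw [← sum_mul, sum_add_distrib, ← mul_sum, sum_sub_distrib, ← sum_div, hsum]
  simp only [sum_const, nsmul_eq_mul, mul_one]
  field_simp
  ring

theorem rate_le {F N r : ℕ} (hF : 0 < F) (hN : 0 < N) (hr : 0 < r) {R : ℝ}
    (hR : R ∈ achievableRates F N ((r : ℝ) / N)) :
    R ≤ (∑ f ∈ range F, ((r : ℝ) ^ f)⁻¹)⁻¹ := by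
  obtain ⟨B, _, _, _, P, hμ, hc, hp, hrate⟩ := hR
  have hr' : (0 : ℝ) < r := Nat.cast_pos.2 hr
  have hN' : (N : ℝ) ≠ 0 := Nat.cast_ne_zero.2 hN.ne'
  have hB : (0 : ℝ) < Fintype.card B := Nat.cast_pos.2 Fintype.card_pos
  have h1 := Protocol.desiredBound_le_download hc hp (θ := ⟨0, hF⟩) rfl
  have h2 : P.desiredBound univ 0 =
      ∑ i : Fin F, ∑ β, ((#(P.holders (i, β)) : ℝ)⁻¹) ^ i.val := by
    simp [Protocol.desiredBound, Fintype.sum_prod_type]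
  -- Double counting: each of the `N` servers holds `r / N` of file `i`, so its bits have `r`
  -- holders on average.
  have h3 : ∀ i : Fin F, ∑ β, (#(P.holders (i, β)) : ℝ) = r * #(univ : Finset B) := by
    intro i
    have e1 : ∀ β, (#(P.holders (i, β)) : ℝ) =
        ∑ n, if (i, β) ∈ P.store n then 1 else 0 := by
      intro β
      simp [Protocol.holders]
    have e2 : ∀ n, ∑ β, (if (i, β) ∈ P.store n then (1 : ℝ) else 0) =
        (r : ℝ) / N * Fintype.card B := by
      intro n
      rw [← hμ n i]
      simp
    simp only [e1]
    rw [sum_comm]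
    simp only [e2]
    rw [sum_const, card_univ, Fintype.card_fin, nsmul_eq_mul, card_univ]
    field_simp
  have h4 : Fintype.card B * ∑ f ∈ range F, ((r : ℝ) ^ f)⁻¹ ≤ P.download ⟨0, hF⟩ := by
    refine le_trans ?_ h1
    rw [h2, ← Fin.sum_univ_eq_sum_range (fun f => ((r : ℝ) ^ f)⁻¹), mul_sum]
    refine sum_le_sum fun i _ => ?_
    rw [← inv_pow]
    exact card_mul_inv_pow_le_sum
      (fun β _ => Nat.cast_pos.2 (Protocol.holders_nonempty hc (i, β)).card_pos) hr' (h3 i) i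
  have hS : 0 < ∑ f ∈ range F, ((r : ℝ) ^ f)⁻¹ :=
    sum_pos (fun f _ => by positivity) (nonempty_range_iff.2 hF.ne')
  rw [← hrate ⟨0, hF⟩, div_le_iff₀ (lt_of_lt_of_le (mul_pos hB hS) h4), ← div_eq_inv_mul,
    le_div_iff₀ hS]
  exact h4

/-- The bijection between the two ranges extends to their complements by finiteness. This supplies
the relabelling of bits behind privacy. -/
theorem exists_perm_comp_eq {α β : Type*} [Fintype β] {f g : α → β}
    (hf : Function.Injective f) (hg : Function.Injective g) :
    ∃ σ : Equiv.Perm β, ∀ a, σ (f a) = g a := by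
  classical
  let e := (Equiv.ofInjective f hf).symm.trans (Equiv.ofInjective g hg)
  refine ⟨Equiv.extendSubtype (p := (· ∈ Set.range f)) (q := (· ∈ Set.range g)) e, fun a => ?_⟩
  rw [Equiv.extendSubtype_apply_of_mem (p := (· ∈ Set.range f)) (q := (· ∈ Set.range g)) e (f a)
    ⟨a, rfl⟩]
  have : (Equiv.ofInjective f hf).symm ⟨f a, a, rfl⟩ = a :=
    (Equiv.ofInjective f hf).symm_apply_eq.2 rfl
  simp only [e, Equiv.trans_apply, this]
  rfl

/-- A new element `a` adds the sets `insert a T` with `T ⊆ A`, which contribute `∑ x ^ #T = (1 + x)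
^ #A`, the next power. -/
theorem sum_powerset_nonempty_pow {α R : Type*} [DecidableEq α] [CommRing R] (A : Finset α)
    (x : R) : ∑ S ∈ A.powerset with S.Nonempty, x ^ (#S - 1) = ∑ f ∈ range #A, (1 + x) ^ f := by
  induction A using Finset.induction_on with
  | empty => simp [filter_singleton]
  | insert a A ha ih =>
    rw [card_insert_of_notMem ha, sum_range_succ, ← ih, sum_filter, sum_powerset_insert ha,
      ← sum_filter]
    congr 1
    have h : ∀ T ∈ A.powerset, (if (insert a T).Nonempty then x ^ (#(insert a T) - 1) else 0) =
        x ^ #T * 1 ^ (#A - #T) := by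
      intro T hT
      rw [if_pos (insert_nonempty a T),
        card_insert_of_notMem fun h => ha (mem_powerset.1 hT h), Nat.add_sub_cancel, one_pow,
        mul_one]
    rw [sum_congr rfl h, sum_pow_mul_eq_add_pow, add_comm]

/-! ### The Sun–Jafar protocol: decoding, symmetry between files, number of sums. -/

section SunJafar

set_option linter.unusedSectionVars false

variable {F : ℕ} {ι B : Type} [Fintype ι] [DecidableEq ι] [Fintype B] [DecidableEq B]

theorem mem_walks_succ {s : ℕ} {l : List ι} :
    l ∈ walks ι (s + 1) ↔ ∃ a t, l = a :: t ∧ t ∈ walks ι s ∧ t.head? ≠ some a := by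
  simp only [walks, mem_image, mem_filter, mem_product, mem_univ, true_and, Prod.exists]
  constructor
  · rintro ⟨a, t, h, rfl⟩
    exact ⟨a, t, rfl, h⟩
  · rintro ⟨a, t, rfl, h⟩
    exact ⟨a, t, h, rfl⟩

theorem exists_cons_of_mem_sums {x : Σ _ : Finset (Fin F), List ι} (hx : x ∈ sums F ι) :
    ∃ a t, x.2 = a :: t ∧ t.head? ≠ some a := by
  obtain ⟨S, l⟩ := x
  simp only [sums, mem_sigma, mem_filter, mem_univ, true_and] at hx
  obtain ⟨s, hs⟩ := Nat.exists_eq_succ_of_ne_zero (card_ne_zero.2 hx.1)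
  rw [hs] at hx
  obtain ⟨a, t, h1, -, h2⟩ := mem_walks_succ.1 hx.2
  exact ⟨a, t, h1, h2⟩

/-- The sums requested from one server contain distinct symbols of each file. -/
theorem symbolAt_injective (θ : Fin F) {x y : Σ _ : Finset (Fin F), List ι}
    (hx : x ∈ sums F ι) (hy : y ∈ sums F ι) (hxy : x.2.head? = y.2.head?) {k : Fin F}
    (h : symbolAt θ x k = symbolAt θ y k) : x = y := by
  obtain ⟨a, t, hx1, hx2⟩ := exists_cons_of_mem_sums hx
  obtain ⟨b, u, hy1, hy2⟩ := exists_cons_of_mem_sums hy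
  obtain ⟨S, l⟩ := x
  obtain ⟨T, m⟩ := y
  simp only at hx1 hy1 hxy
  subst hx1 hy1
  simp only [List.head?_cons, Option.some.injEq] at hxy
  subst hxy
  unfold symbolAt at h
  split_ifs at h with h1 h2 h2
  · simp only [List.tail_cons, Sigma.mk.injEq, heq_eq_eq] at h
    obtain ⟨e1, rfl⟩ := h
    have e2 : S = T := by
      rw [← insert_erase (show θ ∈ S from h1.1), ← insert_erase (show θ ∈ T from h2.1), e1]
    rw [e2]
  -- A new symbol at server `a` has a name starting with `a`, whereas side information used at `a`
  -- comes from another server.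
  · simp only [List.tail_cons, Sigma.mk.injEq, heq_eq_eq] at h
    rw [h.2] at hx2
    simp at hx2
  · simp only [List.tail_cons, Sigma.mk.injEq, heq_eq_eq] at h
    rw [← h.2] at hy2
    simp at hy2
  · exact h

variable (hB : Fintype.card B = Fintype.card ι ^ F)

theorem image_fst_sumBits (θ : Fin F) (γ : Fin F → Equiv.Perm B) (x : sums F ι) :
    (sumBits hB θ γ x).image Prod.fst = x.1.1 := by
  simp only [sumBits, image_image, Function.comp_def]
  exact attach_image_val

theorem sumBits_nonempty (θ : Fin F) (γ : Fin F → Equiv.Perm B) (x : sums F ι) :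
    (sumBits hB θ γ x).Nonempty := by
  rw [← image_nonempty (f := Prod.fst), image_fst_sumBits]
  have := x.2
  simp only [sums, mem_sigma, mem_filter, mem_univ, true_and] at this
  exact this.1

/-- One common bit already forces a common symbol. Hence a query, although an unordered set, does
not merge distinct sums. -/
theorem sumBits_injective (θ : Fin F) (γ : Fin F → Equiv.Perm B) {x y : sums F ι}
    (hxy : x.1.2.head? = y.1.2.head?) (h : sumBits hB θ γ x = sumBits hB θ γ y) : x = y := by
  obtain ⟨⟨k, β⟩, hk⟩ := sumBits_nonempty hB θ γ x
  have hk' := hk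
  rw [h] at hk'
  simp only [sumBits, mem_image, mem_attach, true_and, Subtype.exists, Prod.mk.injEq] at hk hk'
  obtain ⟨i, hi, rfl, h1⟩ := hk
  obtain ⟨i', hi', rfl, h2⟩ := hk'
  have h3 := (numbering hB i').injective ((γ i').injective (h1.trans h2.symm))
  exact Subtype.ext (symbolAt_injective θ x.2 y.2 hxy (Subtype.mk.inj h3))

/-- The symbol of file `k` with the name `s`. -/
def symbolValue (γ : Fin F → Equiv.Perm B) (w : Files F B) (k : Fin F)
    (s : Σ _ : Finset (Fin F), List ι) : ZMod 2 :=
  if h : s ∈ symbols ι k then w k (γ k (numbering hB k ⟨s, h⟩)) else 0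

theorem sum_sumBits (θ : Fin F) (γ : Fin F → Equiv.Perm B) (w : Files F B) (x : sums F ι) :
    ∑ y ∈ sumBits hB θ γ x, w y.1 y.2 =
      ∑ k ∈ x.1.1, symbolValue hB γ w k (symbolAt θ x.1 k) := by
  rw [sumBits, sum_image, ← sum_attach x.1.1]
  · refine sum_congr rfl fun k _ => ?_
    rw [symbolValue, dif_pos (symbolAt_mem θ x.2 k.2)]
  · exact fun k _ k' _ h => Subtype.ext (Prod.mk.inj h).1

/-- The values of the requested sums determine the desired file. -/
theorem file_eq_of_sums_eq (θ : Fin F) (γ : Fin F → Equiv.Perm B) {w w' : Files F B}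
    (h : ∀ x : sums F ι,
      ∑ y ∈ sumBits hB θ γ x, w y.1 y.2 = ∑ y ∈ sumBits hB θ γ x, w' y.1 y.2) :
    w θ = w' θ := by
  funext β
  obtain ⟨⟨x, hx⟩, hβ⟩ := (numbering hB θ).surjective ((γ θ).symm β)
  have hβ' : γ θ (numbering hB θ ⟨x, hx⟩) = β := by rw [hβ, Equiv.apply_symm_apply]
  obtain ⟨S, l⟩ := x
  have hx' := hx
  simp only [symbols, mem_sigma, mem_filter, mem_univ, true_and] at hx'
  obtain ⟨hθ, hl⟩ := hx'
  -- The wanted bit is the new symbol of the requested sum that bears its name.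
  have hS : (⟨S, l⟩ : Σ _ : Finset (Fin F), List ι) ∈ sums F ι := by
    simp only [sums, mem_sigma, mem_filter, mem_univ, true_and]
    exact ⟨⟨θ, hθ⟩, hl⟩
  have hnew : ∀ w : Files F B, ∑ y ∈ sumBits hB θ γ ⟨_, hS⟩, w y.1 y.2 =
      w θ β + ∑ k ∈ S.erase θ, symbolValue hB γ w k ⟨S.erase θ, l.tail⟩ := by
    intro w
    rw [sum_sumBits, ← add_sum_erase _ _ hθ]
    congr 1
    · rw [symbolAt, if_neg (by simp), symbolValue, dif_pos hx, hβ']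
    · refine sum_congr rfl fun k hk => ?_
      rw [symbolAt, if_pos ⟨hθ, ne_of_mem_erase hk⟩]
  -- Unless `S = {θ}`, the side information is itself a requested sum: its type omits `θ`, so it
  -- consists of new symbols only.
  have hside : ∑ k ∈ S.erase θ, symbolValue hB γ w k ⟨S.erase θ, l.tail⟩ =
      ∑ k ∈ S.erase θ, symbolValue hB γ w' k ⟨S.erase θ, l.tail⟩ := by
    rcases (S.erase θ).eq_empty_or_nonempty with h0 | h0
    · rw [h0, sum_empty, sum_empty]
    have hy : (⟨S.erase θ, l.tail⟩ : Σ _ : Finset (Fin F), List ι) ∈ sums F ι := by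
      simp only [sums, mem_sigma, mem_filter, mem_univ, true_and]
      refine ⟨h0, ?_⟩
      obtain ⟨s, hs⟩ := Nat.exists_eq_succ_of_ne_zero (card_ne_zero_of_mem hθ)
      rw [hs] at hl
      obtain ⟨a, t, rfl, ht, -⟩ := mem_walks_succ.1 hl
      rw [card_erase_of_mem hθ, hs]
      exact ht
    have := h ⟨_, hy⟩
    rw [sum_sumBits, sum_sumBits] at this
    simpa [symbolAt] using this
  have := h ⟨_, hS⟩
  rw [hnew, hnew, hside] at this
  exact add_right_cancel this

/-- The queries to one server for two desired files differ by permutations of the bits. -/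
theorem exists_perm_sunJafarQuery_eq (θ θ' : Fin F) (n : ι) : ∃ σ : Fin F → Equiv.Perm B,
    ∀ γ, sunJafarQuery hB θ (fun k => γ k * σ k) n = sunJafarQuery hB θ' γ n := by
  -- Matching sum by sum the symbols of file `k` seen at server `n` for `θ` and for `θ'` is well
  -- defined, since both lists are free of repetitions.
  have h : ∀ k : Fin F, ∃ σ : Equiv.Perm B,
      ∀ x : {x : sums F ι // x.1.2.head? = some n ∧ k ∈ x.1.1},
        σ (numbering hB k ⟨_, symbolAt_mem θ x.1.2 x.2.2⟩) =
          numbering hB k ⟨_, symbolAt_mem θ' x.1.2 x.2.2⟩ := by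
    intro k
    have hinj : ∀ θ : Fin F, Function.Injective
        fun x : {x : sums F ι // x.1.2.head? = some n ∧ k ∈ x.1.1} =>
          numbering hB k ⟨_, symbolAt_mem θ x.1.2 x.2.2⟩ := by
      intro θ x y hxy
      have := Subtype.mk.inj ((numbering hB k).injective hxy)
      exact Subtype.ext (Subtype.ext (symbolAt_injective θ x.1.2 y.1.2
        (x.2.1.trans y.2.1.symm) this))
    exact exists_perm_comp_eq (hinj θ) (hinj θ')
  choose σ hσ using h
  refine ⟨σ, fun γ => image_congr fun x hx => ?_⟩
  have hx' : x.1.2.head? = some n := by simpa using hx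
  unfold sumBits
  refine image_congr fun k _ => ?_
  simp only [Equiv.Perm.mul_apply]
  rw [hσ k.1 ⟨x, hx', k.2⟩]

theorem card_sums (hι : 0 < Fintype.card ι) :
    #(sums F ι) = Fintype.card ι * ∑ f ∈ range F, Fintype.card ι ^ f := by
  -- Over the integers `x = r - 1` is a true subtraction, and `1 + x = r`.
  zify
  have h := sum_powerset_nonempty_pow (univ : Finset (Fin F)) ((Fintype.card ι : ℤ) - 1)
  rw [card_univ, Fintype.card_fin, add_sub_cancel] at h
  rw [← h, sums, card_sigma, mul_sum, powerset_univ]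
  push_cast
  refine sum_congr rfl fun S hS => ?_
  obtain ⟨s, hs⟩ := Nat.exists_eq_succ_of_ne_zero (card_ne_zero.2 (mem_filter.1 hS).2)
  rw [hs, Nat.succ_eq_add_one, card_walks, Nat.add_sub_cancel]
  push_cast [Nat.cast_sub (Nat.succ_le_of_lt hι)]
  simp

end SunJafar

/-! ### The protocol of a tactical configuration and the capacity. -/

namespace TacticalConfiguration

variable {v k b r : ℕ} (C : TacticalConfiguration v k b r) (F : ℕ)

theorem incidence_eq_one_iff {j : Fin v} {n : Fin b} :
    C.incidence j n = 1 ↔ j ∈ C.block n := by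
  simp [incidence]

/-- Both sides count the incident pairs of a point and a block. -/
theorem mul_eq_mul (C : TacticalConfiguration v k b r) : v * r = b * k := by
  have h := sum_card_bipartiteAbove_eq_sum_card_bipartiteBelow (s := (univ : Finset (Fin v)))
    (t := (univ : Finset (Fin b))) fun j n => j ∈ C.block n
  simpa [bipartiteAbove, bipartiteBelow, C.card_block, C.card_blocks_of_point] using h

theorem block_size_pos (C : TacticalConfiguration v k b r) (hb : 0 < b) : 0 < k := by
  rw [← C.card_block ⟨0, hb⟩]
  exact (C.block_nonempty _).card_pos

theorem points_pos (C : TacticalConfiguration v k b r) (hb : 0 < b) : 0 < v :=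
  Nat.pos_of_mul_pos_right (C.mul_eq_mul ▸ Nat.mul_pos hb (C.block_size_pos hb))

theorem replication_pos (C : TacticalConfiguration v k b r) (hb : 0 < b) : 0 < r :=
  Nat.pos_of_mul_pos_left (C.mul_eq_mul ▸ Nat.mul_pos hb (C.block_size_pos hb))

theorem isMuSystem_store (hb : 0 < b) : IsMuSystem ((r : ℝ) / b) (C.store F) := by
  intro n i
  have h : ({x | (i, x) ∈ C.store F n} : Finset (Bit v r F)) = C.block n ×ˢ univ := by
    ext x
    simp [store, incidence_eq_one_iff]
  have hb' : (b : ℝ) ≠ 0 := Nat.cast_ne_zero.2 hb.ne'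
  have h1 : (v : ℝ) * r = b * k := mod_cast C.mul_eq_mul
  rw [h, card_product, C.card_block, Fintype.card_prod, Fintype.card_fin, card_univ,
    Fintype.card_fin]
  push_cast
  rw [div_mul_eq_mul_div, eq_div_iff hb']
  linear_combination (-(r : ℝ) ^ F) * h1

theorem isMuSystem_subfileStore (j : Fin v) :
    IsMuSystem 1 (fun n : C.Holder j => C.subfileStore F j n.1) := by
  intro n i
  have h : ({x | (i, x) ∈ C.subfileStore F j n.1} : Finset (Fin (r ^ F))) = univ := by
    ext x
    simp [subfileStore, C.mem_store F n.2]
  rw [h, one_mul, card_univ]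

theorem incidence_eq_one_iff_forall_mem_store (hb : 0 < b) (j : Fin v) (i : Fin F) (n : Fin b) :
    C.incidence j n = 1 ↔ ∀ p : Fin (r ^ F), (i, (j, p)) ∈ C.store F n := by
  refine ⟨fun h p => C.mem_store F h i p, fun h => ?_⟩
  -- The quantifier over bit positions is not vacuous, because `r ^ F > 0`.
  simpa [store] using h ⟨0, pow_pos (C.replication_pos hb) F⟩

/-- The position in server `n` of the position `x` in the `j`-th subfiles. -/
def position {j : Fin v} {n : Fin b} (h : C.incidence j n = 1) (x : Fin F × Fin (r ^ F)) :
    C.store F n := ⟨(x.1, (j, x.2)), C.mem_store F h x.1 x.2⟩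

theorem position_injective {j : Fin v} {n : Fin b} (h : C.incidence j n = 1) :
    Function.Injective (C.position F h) := by
  rintro ⟨i, p⟩ ⟨i', p'⟩ hx
  simpa [position] using hx

variable {F}

/-- The part of the query to server `n` that concerns the `j`-th subfiles. -/
def subquery (θ : Fin F) (γ : Fin F → Equiv.Perm (Fin (r ^ F))) (n : Fin b) (j : Fin v) :
    Finset (Finset (C.store F n)) :=
  if h : C.incidence j n = 1 then
    (sunJafarQuery (C.card_bits_subfile F j) θ γ (⟨n, h⟩ : C.Holder j)).image
      (image (C.position F h))
  else ∅

theorem query_eq (θ : Fin F) (γ : Fin v → Fin F → Equiv.Perm (Fin (r ^ F))) (n : Fin b) :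
    C.query F θ γ n = univ.biUnion fun j => C.subquery θ (γ j) n j := rfl

theorem mem_subquery {θ : Fin F} {γ : Fin F → Equiv.Perm (Fin (r ^ F))} {n : Fin b} {j : Fin v}
    {s : Finset (C.store F n)} : s ∈ C.subquery θ γ n j ↔
      ∃ (h : C.incidence j n = 1) (x : sums F (C.Holder j)),
        x.1.2.head? = some ⟨n, h⟩ ∧
          (sumBits (C.card_bits_subfile F j) θ γ x).image (C.position F h) = s := by
  unfold subquery
  split_ifs with h
  · simp [sunJafarQuery, h]
  · simp [h]

theorem mem_query {θ : Fin F} {γ : Fin v → Fin F → Equiv.Perm (Fin (r ^ F))} {n : Fin b}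
    {s : Finset (C.store F n)} : s ∈ C.query F θ γ n ↔
      ∃ (j : Fin v) (h : C.incidence j n = 1) (x : sums F (C.Holder j)),
        x.1.2.head? = some ⟨n, h⟩ ∧
          (sumBits (C.card_bits_subfile F j) θ (γ j) x).image (C.position F h) = s := by
  simp only [query_eq, mem_biUnion, mem_univ, true_and, mem_subquery]

theorem protocol_isCorrect : (C.protocol F).IsCorrect := by
  rw [Protocol.isCorrect_iff]
  intro θ q hq w w' hw
  obtain ⟨γ, -, rfl⟩ := (PMF.mem_support_map_iff _ _ _).1 ((PMF.mem_support_iff _ _).2 hq)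
  funext ⟨j, p⟩
  refine congr_fun (file_eq_of_sums_eq (C.card_bits_subfile F j) θ (γ j)
    (w := fun i p => w i (j, p)) (w' := fun i p => w' i (j, p)) fun x => ?_) p
  obtain ⟨⟨n, h⟩, t, hx, -⟩ := exists_cons_of_mem_sums x.2
  have hs := (C.mem_query (θ := θ) (γ := γ)).2 ⟨j, h, x, by rw [hx]; rfl, rfl⟩
  -- Both answers list the sums in the same order, that of `q.toList`, so equal lists give equal
  -- values of each sum.
  have h1 := List.map_inj_left.1 (congr_fun hw n) _ (mem_toList.2 hs)
  have key : ∀ w : Files F (Bit v r F),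
      ∑ z ∈ (sumBits (C.card_bits_subfile F j) θ (γ j) x).image (C.position F h),
        w z.1.1 z.1.2 = ∑ y ∈ sumBits (C.card_bits_subfile F j) θ (γ j) x, w y.1 (j, y.2) :=
    fun w => sum_image fun y _ y' _ hy => C.position_injective F h hy
  exact (key w).symm.trans (h1.trans (key w'))

theorem expect_protocol (θ : Fin F) (φ : (∀ n, (C.protocol F).Query n) → ℝ) :
    (C.protocol F).expect θ φ =
      ∑ γ, weight (PMF.uniformOfFintype (Fin v → Fin F → Equiv.Perm (Fin (r ^ F)))) γ *
        φ (C.query F θ γ) := by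
  exact sum_weight_map _ _ φ

theorem exists_perm_subquery_eq (θ θ' : Fin F) (n : Fin b) (j : Fin v) :
    ∃ σ : Fin F → Equiv.Perm (Fin (r ^ F)),
      ∀ γ, C.subquery θ (fun i => γ i * σ i) n j = C.subquery θ' γ n j := by
  by_cases h : C.incidence j n = 1
  · obtain ⟨σ, hσ⟩ := exists_perm_sunJafarQuery_eq (C.card_bits_subfile F j) θ θ'
      (⟨n, h⟩ : C.Holder j)
    refine ⟨σ, fun γ => ?_⟩
    rw [subquery, subquery, dif_pos h, dif_pos h, hσ γ]
  · refine ⟨1, fun γ => ?_⟩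
    rw [subquery, subquery, dif_neg h, dif_neg h]

/-- Right translation by the relabelling `σ` preserves the uniform law of the permutations and turns
the query to server `n` for `θ` into that for `θ'`. -/
theorem protocol_isPrivate : (C.protocol F).IsPrivate := by
  refine Protocol.isPrivate_of_expect_eq fun n φ θ θ' => ?_
  choose σ hσ using C.exists_perm_subquery_eq θ θ' n
  have h : ∀ γ, C.query F θ (γ * σ) n = C.query F θ' γ n := by
    intro γ
    rw [query_eq, query_eq]
    exact congrArg _ (funext fun j => hσ j (γ j))
  rw [expect_protocol, expect_protocol]
  symm
  refine Fintype.sum_equiv (Equiv.mulRight σ) _ _ fun γ => ?_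
  rw [Equiv.coe_mulRight, h γ]
  simp [weight, PMF.uniformOfFintype_apply]

/-- Sums are nonempty and those for distinct `j` use disjoint positions, so the union is disjoint.
Writing the condition with `Option.map` keeps the count meaningful, namely `0`, when server `n` does
not hold `j`. -/
theorem card_query (θ : Fin F) (γ : Fin v → Fin F → Equiv.Perm (Fin (r ^ F))) (n : Fin b) :
    #(C.query F θ γ n) = ∑ j, #{x : sums F (C.Holder j) |
      x.1.2.head?.map Subtype.val = some n} := by
  have hhead : ∀ {j} (h : C.incidence j n = 1) (x : sums F (C.Holder j)),
      x.1.2.head?.map Subtype.val = some n ↔ x.1.2.head? = some ⟨n, h⟩ := by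
    intro j h x
    obtain ⟨a, t, hx, -⟩ := exists_cons_of_mem_sums x.2
    simp [hx, Subtype.ext_iff]
  rw [query_eq, card_biUnion]
  · refine sum_congr rfl fun j _ => ?_
    by_cases h : C.incidence j n = 1
    · rw [subquery, dif_pos h,
        card_image_of_injective _ (image_injective (C.position_injective F h)),
        sunJafarQuery, card_image_of_injOn]
      · simp only [hhead h]
      · intro x hx y hy hxy
        simp only [coe_filter, mem_univ, true_and, Set.mem_ofPred_eq] at hx hy
        exact sumBits_injective _ θ _ (hx.trans hy.symm) hxy
    · rw [subquery, dif_neg h, card_empty, eq_comm, card_eq_zero, filter_eq_empty_iff]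
      intro x _ hx
      obtain ⟨a, t, hx', -⟩ := exists_cons_of_mem_sums x.2
      rw [hx', List.head?_cons, Option.map_some, Option.some.injEq] at hx
      exact h (hx ▸ a.2)
  · intro j _ j' _ hjj'
    refine disjoint_left.2 fun s hs hs' => hjj' ?_
    obtain ⟨h, x, -, rfl⟩ := C.mem_subquery.1 hs
    obtain ⟨h', x', -, he⟩ := C.mem_subquery.1 hs'
    obtain ⟨y, hy⟩ := sumBits_nonempty (C.card_bits_subfile F j) θ (γ j) x
    have hmem := mem_image_of_mem (C.position F h) hy
    rw [← he] at hmem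
    obtain ⟨y', -, hy'⟩ := mem_image.1 hmem
    exact (congrArg (fun z : C.store F n => z.1.2.1) hy').symm

theorem sum_card_query (hb : 0 < b) (θ : Fin F)
    (γ : Fin v → Fin F → Equiv.Perm (Fin (r ^ F))) :
    ∑ n, #(C.query F θ γ n) = v * (r * ∑ f ∈ range F, r ^ f) := by
  simp only [card_query]
  rw [sum_comm]
  have h : ∀ j, ∑ n, #{x : sums F (C.Holder j) | x.1.2.head?.map Subtype.val = some n} =
      r * ∑ f ∈ range F, r ^ f := by
    intro j
    have h1 := card_sums (F := F) (ι := C.Holder j) (by rw [C.card_holder]; exact C.replication_pos hb)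
    rw [C.card_holder] at h1
    rw [← h1, ← Fintype.card_coe, ← card_univ, card_eq_sum_ones]
    simp only [card_filter]
    rw [sum_comm]
    refine sum_congr rfl fun x _ => ?_
    obtain ⟨a, t, hx, -⟩ := exists_cons_of_mem_sums x.2
    simp [hx]
  rw [sum_congr rfl fun j _ => h j, sum_const, card_univ, Fintype.card_fin, smul_eq_mul]

theorem download_protocol (hb : 0 < b) (θ : Fin F) :
    (C.protocol F).download θ = v * (r * ∑ f ∈ range F, (r : ℝ) ^ f) := by
  refine (C.expect_protocol θ fun q => ∑ n, ((C.protocol F).answerLength n (q n) : ℝ)).trans ?_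
  have h : ∀ γ, ∑ n, ((C.protocol F).answerLength n (C.query F θ γ n) : ℝ) =
      v * (r * ∑ f ∈ range F, (r : ℝ) ^ f) := fun γ => mod_cast C.sum_card_query hb θ γ
  simp only [h]
  rw [← sum_mul, sum_weight, one_mul]

theorem card_bit : Fintype.card (Bit v r F) = v * r ^ F := by
  simp

theorem protocol_hasRate (hb : 0 < b) :
    (C.protocol F).HasRate (∑ f ∈ range F, ((r : ℝ) ^ f)⁻¹)⁻¹ := by
  intro θ
  have hv : (v : ℝ) ≠ 0 := Nat.cast_ne_zero.2 (C.points_pos hb).ne'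
  have hr : (r : ℝ) ≠ 0 := Nat.cast_ne_zero.2 (C.replication_pos hb).ne'
  -- Reversing the order of summation pairs `r * r ^ (F - 1 - f)` with `r ^ F * r ^ (-f)`.
  have h : (r : ℝ) * ∑ f ∈ range F, (r : ℝ) ^ f = r ^ F * ∑ f ∈ range F, ((r : ℝ) ^ f)⁻¹ := by
    rw [← sum_range_reflect, mul_sum, mul_sum]
    refine sum_congr rfl fun f hf => ?_
    have hf := mem_range.1 hf
    rw [← pow_succ', ← div_eq_mul_inv, eq_div_iff (pow_ne_zero _ hr), ← pow_add]
    congr 1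
    omega
  rw [C.download_protocol hb, card_bit, h]
  push_cast
  rw [mul_div_mul_left _ _ hv, div_mul_eq_div_div, div_self (pow_ne_zero _ hr), one_div]

/-- The upper bound for all rates is attained by the protocol itself, so it is their supremum. -/
theorem isCapacity (C : TacticalConfiguration v k b r) (hb : 0 < b) (hF : 0 < F) :
    IsCapacity F b ((r : ℝ) / b) (∑ f ∈ range F, ((r : ℝ) ^ f)⁻¹)⁻¹ := by
  have hr := C.replication_pos hb
  refine ⟨fun R hR => rate_le hF hb hr hR, fun R hR => hR ?_⟩
  exact ⟨Bit v r F, inferInstance, inferInstance,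
    ⟨(⟨0, C.points_pos hb⟩, ⟨0, pow_pos hr F⟩)⟩, C.protocol F, C.isMuSystem_store F hb,
    C.protocol_isCorrect, C.protocol_isPrivate, C.protocol_hasRate hb⟩

end TacticalConfiguration

end PIR

end

theorem theorem1 (v k b r F : ℕ) (hb : 0 < b) (hF : 0 < F)
    (C : PIR.TacticalConfiguration v k b r) :
    -- the storage is that of a `μ`-`(F, b)` system with `μ = r / b = k / v`
    (PIR.IsMuSystem ((r : ℝ) / b) (C.store F) ∧ (r : ℝ) / b = (k : ℝ) / v) ∧
    -- the servers that hold the `j`-th subfiles form a `1`-`(F, r)` system for these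
    (∀ j : Fin v,
      (∀ (i : Fin F) (n : Fin b),
        C.incidence j n = 1 ↔ ∀ p : Fin (r ^ F), (i, (j, p)) ∈ C.store F n) ∧
      Fintype.card (C.Holder j) = r ∧
      PIR.IsMuSystem 1 (fun n : C.Holder j => C.subfileStore F j n.1)) ∧
    -- the file size is `v * r ^ F`
    Fintype.card (PIR.TacticalConfiguration.Bit v r F) = v * r ^ F ∧
    (C.protocol F).IsCorrect ∧
    (C.protocol F).IsPrivate ∧
    (C.protocol F).HasRate (∑ f ∈ Finset.range F, ((r : ℝ) ^ f)⁻¹)⁻¹ ∧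
    PIR.IsCapacity F b ((r : ℝ) / b) (∑ f ∈ Finset.range F, ((r : ℝ) ^ f)⁻¹)⁻¹ := by
  have hbk : (r : ℝ) / b = (k : ℝ) / v := by
    rw [div_eq_div_iff (Nat.cast_ne_zero.2 hb.ne') (Nat.cast_ne_zero.2 (C.points_pos hb).ne')]
    have h : (v : ℝ) * r = b * k := mod_cast C.mul_eq_mul
    linarith
  exact ⟨⟨C.isMuSystem_store F hb, hbk⟩,
    fun j => ⟨C.incidence_eq_one_iff_forall_mem_store F hb j, C.card_holder j,
      C.isMuSystem_subfileStore F j⟩,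
    PIR.TacticalConfiguration.card_bit, C.protocol_isCorrect, C.protocol_isPrivate,
    C.protocol_hasRate hb, C.isCapacity hb hF⟩
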